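/- Let $0<m<1$ and work in $L^2=L^2(]0,\infty[)$ with complex scalars. Let $L_m^{\max}$ be the operator $f\mapsto -f''+(m^2-\tfrac14)x^{-2}f$ (in the sense of distributions on $]0,\infty[$) on the domain of all $f\in L^2$ whose image is in $L^2$, and let $L_m^{\min}$ be the closure of its restriction to $C_c^\infty(]0,\infty[)$. Let $\xi$ be a smooth function with $\xi=1$ on $[0,1]$ and $\xi=0$ on $[2,\infty[$. For $\nu\in\{m,-m\}$ let $H_\nu$ be the restriction of $L_m^{\max}$ to $\mathcal D(L_m^{\min})+\mathbb C\,\xi(x)x^{1/2+\nu}$. For $0\le\theta<\pi$ put $u_\theta(x)=x^{1/2-m}\cos\theta+x^{1/2+m}\sin\theta$, and let $H_m^\theta$ be the restriction of $L_m^{\max}$ to the set of those $f\in\mathcal D(L_m^{\max})$ (which have a $C^1$ version on $]0,\infty[$) with $\lim_{x\to0}\bigl(u_\theta(x)f'(x)-u_\theta'(x)f(x)\bigr)=0$. The Friedrichs and Krein extensions of a positive hermitian operator $S$ (densely defined, symmetric, $\langle f,Sf\rangle\ge0$) are its positive self-adjoint extensions $F$ and $K$ such that every positive self-adjoint extension $H$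 of $S$ satisfies $K\le H\le F$ in the sense of quadratic forms. Here $A\le B$ means that the form domain of $B$ is contained in that of $A$ and $q_A\le q_B$ there, where $q_A$ denotes the closure of the form $\langle f,Af\rangle$, $f\in\mathcal D(A)$. Then: 1. $L_m^{\min}$ is a positive hermitian operator with deficiency indices $(1,1)$. 2. $H_m=H_m^{\pi/2}$ and $H_{-m}=H_m^{0}$, and these operators are respectively the Friedrichs and the Krein extension of $L_m^{\min}$. 3. If $0\le\theta\le\pi/2$, then $H_m^\theta$ is a positive self-adjoint extension of $L_m^{\min}$. 4. If $\pi/2<\theta<\pi$, then $H_m^\theta$ is a self-adjoint extension of $L_m^{\min}$, it has exactly one strictly negative eigenvalue, and this eigenvalue is simple. -/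

import Mathlib

open MeasureTheory Set Filter Topology
open scoped ContDiff InnerProductSpace

noncomputable section

namespace HomSchrodinger

/-! ### Notions for unbounded operators in a Hilbert space -/

section Abstract

variable {E : Type*} [NormedAddCommGroup E] [InnerProductSpace ℂ E]

/-- `ker (T - z)` for an unbounded operator `T`, as a subspace of the Hilbert space. -/
def eigenspace (T : E →ₗ.[ℂ] E) (z : ℂ) : Submodule ℂ E where
  carrier := {x | ∃ h : x ∈ T.domain, T ⟨x, h⟩ = z • x}
  zero_mem' := ⟨T.domain.zero_mem, by
    rw [smul_zero]
    exact T.map_zero⟩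
  add_mem' := by
    rintro x y ⟨hx, ex⟩ ⟨hy, ey⟩
    refine ⟨T.domain.add_mem hx hy, ?_⟩
    rw [smul_add, ← ex, ← ey]
    exact T.map_add ⟨x, hx⟩ ⟨y, hy⟩
  smul_mem' := by
    rintro c x ⟨hx, ex⟩
    refine ⟨T.domain.smul_mem c hx, ?_⟩
    rw [smul_comm, ← ex]
    exact T.map_smul c ⟨x, hx⟩

/-- A hermitian operator: densely defined and symmetric. -/
def IsHermitianOp (T : E →ₗ.[ℂ] E) : Prop :=
  Dense (T.domain : Set E) ∧ ∀ x y : T.domain, ⟪T x, (y : E)⟫_ℂ = ⟪(x : E), T y⟫_ℂ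

/-- A positive hermitian operator: `⟨x, T x⟩ ≥ 0` on the domain. -/
def IsPositiveHermitian (T : E →ₗ.[ℂ] E) : Prop :=
  IsHermitianOp T ∧ ∀ x : T.domain, 0 ≤ (⟪(x : E), T x⟫_ℂ).re

/-- The deficiency indices `(dim ker (T* - i), dim ker (T* + i))`. -/
def HasDeficiencyIndices [CompleteSpace E] (T : E →ₗ.[ℂ] E) (p q : ℕ) : Prop :=
  Module.rank ℂ (eigenspace T.adjoint Complex.I) = p ∧
    Module.rank ℂ (eigenspace T.adjoint (-Complex.I)) = q

/-- `H` is a self-adjoint extension of `S`. -/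
def IsSelfAdjointExtension [CompleteSpace E] (S H : E →ₗ.[ℂ] E) : Prop :=
  S ≤ H ∧ IsSelfAdjoint H

/-- `H` is a positive self-adjoint extension of `S`. -/
def IsPositiveSelfAdjointExtension [CompleteSpace E] (S H : E →ₗ.[ℂ] E) : Prop :=
  IsSelfAdjointExtension S H ∧ ∀ x : H.domain, 0 ≤ (⟪(x : E), H x⟫_ℂ).re

/-- For a positive self-adjoint operator `H`, with quadratic form `q_H` defined as the closure of
`x ↦ ⟨x, H x⟩` on the domain of `H`: the vector `x` belongs to the form domain of `H` and
`q_H(x) = r`. -/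
def IsFormValue (H : E →ₗ.[ℂ] E) (x : E) (r : ℝ) : Prop :=
  ∃ u : ℕ → H.domain,
    Tendsto (fun n => (u n : E)) atTop (𝓝 x) ∧
    Tendsto (fun p : ℕ × ℕ => (⟪((u p.1 - u p.2 : H.domain) : E), H (u p.1 - u p.2)⟫_ℂ).re)
      atTop (𝓝 0) ∧
    Tendsto (fun n => (⟪(u n : E), H (u n)⟫_ℂ).re) atTop (𝓝 r)

/-- `A ≤ B` in the sense of quadratic forms, for positive self-adjoint `A` and `B`: the form domain
of `B` is contained in that of `A`, and `q_A ≤ q_B` on the form domain of `B`. -/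
def FormLE (A B : E →ₗ.[ℂ] E) : Prop :=
  ∀ (x : E) (r : ℝ), IsFormValue B x r → ∃ s : ℝ, s ≤ r ∧ IsFormValue A x s

/-- `F` is the Friedrichs extension of `S`: the largest positive self-adjoint extension. -/
def IsFriedrichsExtension [CompleteSpace E] (S F : E →ₗ.[ℂ] E) : Prop :=
  IsPositiveSelfAdjointExtension S F ∧
    ∀ H : E →ₗ.[ℂ] E, IsPositiveSelfAdjointExtension S H → FormLE H F

/-- `K` is the Krein extension of `S`: the smallest positive self-adjoint extension. -/
def IsKreinExtension [CompleteSpace E] (S K : E →ₗ.[ℂ] E) : Prop :=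
  IsPositiveSelfAdjointExtension S K ∧
    ∀ H : E →ₗ.[ℂ] E, IsPositiveSelfAdjointExtension S H → FormLE K H

end Abstract

/-! ### The operators on the half-line -/

/-- The open half-line `]0, ∞[`. -/
def halfLine : TopologicalSpace.Opens ℝ := ⟨Ioi 0, isOpen_Ioi⟩

/-- Lebesgue measure on the half-line. -/
abbrev vol : Measure ℝ := volume.restrict (Ioi (0 : ℝ))

/-- The Hilbert space `L²(]0, ∞[)`. -/
abbrev L2 : Type := Lp ℂ 2 vol

/-- Test functions: smooth complex functions with compact support in `]0, ∞[`. -/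
abbrev Test : Type := TestFunction halfLine ℂ ⊤

/-- The differential expression `-φ'' + (m² - 1/4) x⁻² φ`, for twice differentiable `φ`. -/
def diffExpr (m : ℝ) (φ : ℝ → ℂ) (x : ℝ) : ℂ :=
  -deriv (deriv φ) x + (((m ^ 2 - 1 / 4) / x ^ 2 : ℝ) : ℂ) * φ x

theorem continuous_diffExpr (m : ℝ) (φ : Test) : Continuous (diffExpr m φ) := by
  have h2 : Continuous (deriv (deriv (φ : ℝ → ℂ))) := by
    have h : ContDiff ℝ ∞ (φ : ℝ → ℂ) := φ.contDiff
    have h1 : ContDiff ℝ ∞ (deriv (φ : ℝ → ℂ)) := (contDiff_infty_iff_deriv.1 h).2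
    exact (contDiff_infty_iff_deriv.1 h1).2.continuous
  refine h2.neg.add ?_
  refine continuous_of_tsupport fun x hx => ?_
  have hx' : x ∈ Ioi (0 : ℝ) :=
    φ.tsupport_subset (closure_mono (Function.support_mul_subset_right _ _) hx)
  have hx0 : x ≠ 0 := ne_of_gt hx'
  refine ContinuousAt.mul (Complex.continuous_ofReal.continuousAt.comp ?_)
    φ.continuous.continuousAt
  exact continuousAt_const.div (continuousAt_id.pow 2) (pow_ne_zero 2 hx0)

theorem hasCompactSupport_diffExpr (m : ℝ) (φ : Test) : HasCompactSupport (diffExpr m φ) :=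
  (φ.hasCompactSupport.deriv.deriv.neg).add (φ.hasCompactSupport.mul_left)

theorem memLp_diffExpr (m : ℝ) (φ : Test) : MemLp (diffExpr m φ) 2 vol :=
  (continuous_diffExpr m φ).memLp_of_hasCompactSupport (hasCompactSupport_diffExpr m φ)

theorem memLp_test (φ : Test) : MemLp (φ : ℝ → ℂ) 2 vol :=
  φ.continuous.memLp_of_hasCompactSupport φ.hasCompactSupport

theorem integrable_mul_of_memLp (f : L2) {ψ : ℝ → ℂ} (hψ : MemLp ψ 2 vol) :
    Integrable (fun x => f x * ψ x) vol :=
  (Lp.memLp f).integrable_mul hψ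

/-- The graph of the maximal operator: the pairs `(f, g)` of square integrable functions such that
`-f'' + (m² - 1/4) x⁻² f = g` in the sense of distributions on `]0, ∞[`. -/
def maxGraph (m : ℝ) : Submodule ℂ (L2 × L2) where
  carrier := {p | ∀ φ : Test, ∫ x, p.1 x * diffExpr m φ x ∂vol = ∫ x, p.2 x * φ x ∂vol}
  zero_mem' := by
    intro φ
    have h0 : ((0 : L2) : ℝ → ℂ) =ᵐ[vol] 0 := Lp.coeFn_zero _ _ _
    have h1 : ∀ ψ : ℝ → ℂ, ∫ x, (0 : L2) x * ψ x ∂vol = 0 := fun ψ => by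
      rw [integral_congr_ae (g := fun _ => (0 : ℂ)) (by filter_upwards [h0] with x hx; rw [hx, Pi.zero_apply, zero_mul])]
      simp
    exact (h1 _).trans (h1 _).symm
  add_mem' := by
    intro p q hp hq φ
    have h1 : ∀ (f g : L2) (ψ : ℝ → ℂ), MemLp ψ 2 vol → ∫ x, (f + g) x * ψ x ∂vol =
        ∫ x, f x * ψ x ∂vol + ∫ x, g x * ψ x ∂vol := fun f g ψ hψ => by
      rw [← integral_add (integrable_mul_of_memLp f hψ) (integrable_mul_of_memLp g hψ)]
      refine integral_congr_ae ?_
      filter_upwards [Lp.coeFn_add f g] with x hx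
      rw [hx, Pi.add_apply, add_mul]
    change ∫ x, (p.1 + q.1) x * _ ∂vol = ∫ x, (p.2 + q.2) x * _ ∂vol
    rw [h1 _ _ _ (memLp_diffExpr m φ), h1 _ _ _ (memLp_test φ), hp φ, hq φ]
  smul_mem' := by
    intro c p hp φ
    have h1 : ∀ (f : L2) (ψ : ℝ → ℂ), ∫ x, (c • f) x * ψ x ∂vol =
        c * ∫ x, f x * ψ x ∂vol := fun f ψ => by
      rw [← integral_const_mul]
      refine integral_congr_ae ?_
      filter_upwards [Lp.coeFn_smul c f] with x hx
      rw [hx, Pi.smul_apply, smul_eq_mul, mul_assoc]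
    change ∫ x, (c • p.1) x * _ ∂vol = ∫ x, (c • p.2) x * _ ∂vol
    rw [h1, h1, hp φ]

/-- The distribution `-f'' + (m² - 1/4) x⁻² f` determines its density. -/
theorem maxGraph_unique (m : ℝ) (p : L2 × L2) (hp : p ∈ maxGraph m) (h0 : p.1 = 0) :
    p.2 = 0 := by
  have hloc : LocallyIntegrableOn (p.2 : ℝ → ℂ) (Ioi 0) volume := by
    intro x hx
    have hx : (0 : ℝ) < x := hx
    refine ⟨Icc (x / 2) (x + 1), mem_nhdsWithin_of_mem_nhds (Icc_mem_nhds (by linarith)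
      (by linarith)), ?_⟩
    have hr : vol.restrict (Icc (x / 2) (x + 1)) = volume.restrict (Icc (x / 2) (x + 1)) := by
      rw [Measure.restrict_restrict measurableSet_Icc,
        inter_eq_left.2 (fun y hy => lt_of_lt_of_le (by linarith) hy.1 : _ ⊆ Ioi (0 : ℝ))]
    have h := (Lp.memLp p.2).restrict (Icc (x / 2) (x + 1))
    rw [hr] at h
    have : IsFiniteMeasure (volume.restrict (Icc (x / 2) (x + 1))) :=
      ⟨by simp⟩
    exact h.integrable (by norm_num)
  have key := isOpen_Ioi.ae_eq_zero_of_integral_contDiff_smul_eq_zero hloc (fun g hg hc hs => by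
    let φ : Test := ⟨fun x => (g x : ℂ), Complex.ofRealCLM.contDiff.comp hg,
      hc.comp_left (g := fun t : ℝ => (t : ℂ)) Complex.ofReal_zero,
      (closure_mono (Function.support_comp_subset (g := fun t : ℝ => (t : ℂ))
        Complex.ofReal_zero g)).trans hs⟩
    have h1 := hp φ
    rw [h0, integral_congr_ae (g := fun _ => (0 : ℂ)) (by
      filter_upwards [Lp.coeFn_zero ℂ 2 vol] with x hx
      rw [hx, Pi.zero_apply, zero_mul]), integral_zero] at h1
    rw [← setIntegral_eq_integral_of_forall_compl_eq_zero (s := Ioi (0 : ℝ))]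
    · rw [h1]
      refine integral_congr_ae (Eventually.of_forall fun x => ?_)
      change (g x) • (p.2 x) = p.2 x * (g x : ℂ)
      rw [Complex.real_smul, mul_comm]
    · intro x hx
      have : g x = 0 := image_eq_zero_of_notMem_tsupport fun h => hx (hs h)
      simp [this])
  refine Lp.ext ?_
  have h2 : ∀ᵐ x ∂vol, p.2 x = 0 := (ae_restrict_iff' measurableSet_Ioi).2 key
  filter_upwards [h2, Lp.coeFn_zero ℂ 2 vol] with x hx hx0
  rw [hx, hx0, Pi.zero_apply]

theorem isClosed_maxGraph (m : ℝ) : IsClosed (maxGraph m : Set (L2 × L2)) := by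
  have hc : ∀ ψ : ℝ → ℂ, MemLp ψ 2 vol → Continuous fun f : L2 => ∫ x, f x * ψ x ∂vol := by
    intro ψ hψ
    have hψ' : MemLp (fun x => star (ψ x)) 2 vol := hψ.star
    have : (fun f : L2 => ∫ x, f x * ψ x ∂vol) = fun f : L2 => ⟪hψ'.toLp _, f⟫_ℂ := by
      funext f
      rw [L2.inner_def]
      refine integral_congr_ae ?_
      filter_upwards [hψ'.coeFn_toLp] with x hx
      rw [hx]
      simp
    rw [this]
    exact continuous_const.inner continuous_id
  have : (maxGraph m : Set (L2 × L2)) = ⋂ φ : Test,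
      {p : L2 × L2 | ∫ x, p.1 x * diffExpr m φ x ∂vol = ∫ x, p.2 x * φ x ∂vol} := by
    ext p
    simp only [mem_iInter]
    rfl
  rw [this]
  exact isClosed_iInter fun φ => isClosed_eq
    ((hc _ (memLp_diffExpr m φ)).comp continuous_fst) ((hc _ (memLp_test φ)).comp continuous_snd)

/-- The maximal operator `L_m^max`. -/
def Lmax (m : ℝ) : L2 →ₗ.[ℂ] L2 := (maxGraph m).toLinearPMap

theorem graph_Lmax (m : ℝ) : (Lmax m).graph = maxGraph m :=
  Submodule.toLinearPMap_graph_eq _ (maxGraph_unique m)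

/-- The subspace `C_c^∞(]0, ∞[)` of `L²(]0, ∞[)`. -/
def testSubspace : Submodule ℂ L2 where
  carrier := {f | ∃ φ : Test, f =ᵐ[vol] φ}
  zero_mem' := ⟨0, Lp.coeFn_zero _ _ _⟩
  add_mem' := by
    rintro f g ⟨φ, hφ⟩ ⟨ψ, hψ⟩
    refine ⟨φ + ψ, ?_⟩
    filter_upwards [Lp.coeFn_add f g, hφ, hψ] with x h h1 h2
    rw [h, Pi.add_apply, h1, h2]
    rfl
  smul_mem' := by
    rintro c f ⟨φ, hφ⟩
    refine ⟨c • φ, ?_⟩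
    filter_upwards [Lp.coeFn_smul c f, hφ] with x h h1
    rw [h, Pi.smul_apply, h1]
    rfl

/-- The minimal operator `L_m^min`: the closure of the restriction of `L_m^max` to
`C_c^∞(]0, ∞[)`. -/
def Lmin (m : ℝ) : L2 →ₗ.[ℂ] L2 := ((Lmax m).domRestrict testSubspace).closure

/-- The closure in the definition of `L_m^min` is a genuine closure. -/
theorem isClosable_core (m : ℝ) : ((Lmax m).domRestrict testSubspace).IsClosable := by
  have h : (Lmax m).IsClosed := by
    rw [LinearPMap.IsClosed, graph_Lmax]
    exact isClosed_maxGraph m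
  exact h.isClosable.leIsClosable LinearPMap.domRestrict_le

/-- A smooth cut-off function, equal to `1` on `]-∞, 1]` and to `0` on `[2, ∞[`. -/
def IsCutoff (ξ : ℝ → ℂ) : Prop :=
  ContDiff ℝ ∞ ξ ∧ (∀ x ≤ 1, ξ x = 1) ∧ ∀ x, 2 ≤ x → ξ x = 0

/-- The subspace `D(L_m^min) + ℂ ξ ζ_m`, where `ζ_m(x) = x^(1/2 + m)`. -/
def homDomain (ξ : ℝ → ℂ) (m : ℝ) : Submodule ℂ L2 where
  carrier := {f | ∃ f₀ ∈ (Lmin m).domain, ∃ c : ℂ,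
    f =ᵐ[vol] fun x => f₀ x + c * (ξ x * ((x ^ (1 / 2 + m) : ℝ) : ℂ))}
  zero_mem' := ⟨0, (Lmin m).domain.zero_mem, 0, by simp⟩
  add_mem' := by
    rintro f g ⟨f₀, hf₀, c, hf⟩ ⟨g₀, hg₀, d, hg⟩
    refine ⟨f₀ + g₀, (Lmin m).domain.add_mem hf₀ hg₀, c + d, ?_⟩
    filter_upwards [Lp.coeFn_add f g, Lp.coeFn_add f₀ g₀, hf, hg] with x h1 h2 h3 h4
    rw [h1, h2, Pi.add_apply, Pi.add_apply, h3, h4]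
    ring
  smul_mem' := by
    rintro a f ⟨f₀, hf₀, c, hf⟩
    refine ⟨a • f₀, (Lmin m).domain.smul_mem a hf₀, a * c, ?_⟩
    filter_upwards [Lp.coeFn_smul a f, Lp.coeFn_smul a f₀, hf] with x h1 h2 h3
    rw [h1, h2, Pi.smul_apply, Pi.smul_apply, h3, smul_eq_mul, smul_eq_mul]
    ring

/-- The operator `H_m` (for `m > -1`): the restriction of `L_m^max` to `D(L_m^min) + ℂ ξ ζ_m`. -/
def Hop (ξ : ℝ → ℂ) (m : ℝ) : L2 →ₗ.[ℂ] L2 := (Lmax m).domRestrict (homDomain ξ m)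

/-- The square integrable functions `f` which have a continuously differentiable version on
`]0, ∞[` and whose Wronskian with `u` satisfies `lim_{x → 0} (u f' - u' f)(x) = 0`. -/
def wronskianKer (u : ℝ → ℂ) : Submodule ℂ L2 where
  carrier := {f | ∃ F : ℝ → ℂ, f =ᵐ[vol] F ∧ ContDiffOn ℝ 1 F (Ioi 0) ∧
    Tendsto (fun x => u x * deriv F x - deriv u x * F x) (𝓝[>] 0) (𝓝 0)}
  zero_mem' := ⟨0, Lp.coeFn_zero _ _ _, contDiffOn_const, by simp⟩
  add_mem' := by
    rintro f g ⟨F, hF, dF, wF⟩ ⟨G, hG, dG, wG⟩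
    refine ⟨F + G, (Lp.coeFn_add f g).trans (hF.add hG), dF.add dG, ?_⟩
    have h := wF.add wG
    rw [add_zero] at h
    refine h.congr' ?_
    filter_upwards [self_mem_nhdsWithin] with x hx
    have aF := (dF.differentiableOn (by norm_num)).differentiableAt (isOpen_Ioi.mem_nhds hx)
    have aG := (dG.differentiableOn (by norm_num)).differentiableAt (isOpen_Ioi.mem_nhds hx)
    rw [deriv_add aF aG, Pi.add_apply]
    ring
  smul_mem' := by
    rintro c f ⟨F, hF, dF, wF⟩
    refine ⟨c • F, (Lp.coeFn_smul c f).trans (hF.const_smul c), dF.const_smul c, ?_⟩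
    have h := wF.const_mul c
    rw [mul_zero] at h
    refine h.congr' ?_
    filter_upwards [self_mem_nhdsWithin] with x hx
    have aF := (dF.differentiableOn (by norm_num)).differentiableAt (isOpen_Ioi.mem_nhds hx)
    rw [deriv_const_smul c aF, Pi.smul_apply, smul_eq_mul, smul_eq_mul]
    ring

/-- The operator `L_m^u`: the restriction of `L_m^max` to the `f` whose Wronskian with `u` tends
to `0` at the origin. -/
def Lext (m : ℝ) (u : ℝ → ℂ) : L2 →ₗ.[ℂ] L2 := (Lmax m).domRestrict (wronskianKer u)

/-- The function `u_θ(x) = x^(1/2 - m) cos θ + x^(1/2 + m) sin θ`. -/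
def uTheta (m θ : ℝ) (x : ℝ) : ℂ :=
  ((x ^ (1 / 2 - m) * Real.cos θ + x ^ (1 / 2 + m) * Real.sin θ : ℝ) : ℂ)

/-- The operator `H_m^θ = L_m^{u_θ}`. -/
def Htheta (m θ : ℝ) : L2 →ₗ.[ℂ] L2 := Lext m (uTheta m θ)

end HomSchrodinger

end

/-!
# Self-adjoint realisations of `-∂² + (m² - 1/4) x⁻²` for `0 < m < 1`

Put `p(x) = x^(1/2 - m)`. On the half-line the operator factorises as `L = A* A`, where
`A f = f' - (1/2 - m) f / x = p (f / p)'`, so that `L f = g` becomes a first-order system for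
`u = f / p` and `K = p² u' = p A f`:
`u' = K / p²` and `K' = -p g` (`Sol`).
By Weyl's lemma (`exists_sol`) every element of the maximal domain is of this form. Since
`0 < m < 1`, the functions `p` and `1 / p` are square integrable at the origin, so `u` and `K` have
limits `a` and `2 m b` there: these are the coefficients of `x^(1/2 - m)` and `x^(1/2 + m)` in the
expansion of `f`. Moreover `A f` is square integrable on the whole half-line (`Sol.memLp_div`), and
integrating `(ū K)'` yields Green's identity (`BData.inner_eq`)

`⟪f₁, L f₂⟫ = ⟪A f₁, A f₂⟫ + 2 m ā₁ b₂`.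

Everything else follows from this identity and from the behaviour of its terms under dilations
(`BData.dil`). The adjoint of the minimal operator is the maximal one, hence the minimal domain is
given by `a = b = 0` (`mem_graph_Lmin`); the Wronskian condition defining `H_m^θ` reads
`b cos θ = a sin θ` (`mem_graph_Htheta`). Self-adjointness of `H_m^θ` is the fact that these lines
are Lagrangian for the form `b̄₁ a₂ - ā₁ b₂`, and positivity for `0 ≤ θ ≤ π/2` is the sign of
`Re (ā b)`.

For `z` outside of `[0, ∞[` the operator `H_m^{π/2} - z` is onto, which shows that the kernel of
`Lmax - z` is a line on which `a ≠ 0` (`exists_eigenfunction`). For `z = ± i` this gives the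
deficiency indices. For `z = -k²`, Green's identity and dilations give `b / a = -β k^(2 m)` with
`β > 0`, and the equation `-β k^(2 m) = tan θ` has exactly one solution `k > 0` if `π/2 < θ < π`.

Finally, there are elements with boundary values `(0, 1)` for which `f` and `A f` are both
arbitrarily small, and elements with boundary values `(1, 0)` for which `A f` is arbitrarily small.
The second fact, together with the first, forces `Re (ā b) ≥ 0` on the domain of every positive
self-adjoint extension (`re_conj_mul_nonneg`). The first fact allows one to remove the boundary
value `b` at no cost, which leads from the domain of `H_m^{π/2}` into the minimal domain, and from
the domain of an arbitrary positive extension into that of `H_m^0`, where only the term `‖A f‖²` of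
the energy survives (`formLE_of_bData`). These are the extremal properties of the Friedrichs and of
the Krein extension.
-/

open scoped ComplexConjugate

noncomputable section

namespace HomSchrodinger

/-! ### Locally absolutely continuous functions on the half-line -/

theorem absolutelyContinuousOnInterval_ofReal {f : ℝ → ℝ} {a b : ℝ}
    (hf : AbsolutelyContinuousOnInterval f a b) :
    AbsolutelyContinuousOnInterval (fun x => (f x : ℂ)) a b := by
  unfold AbsolutelyContinuousOnInterval at hf ⊢
  simpa only [Complex.isometry_ofReal.dist_eq] using hf

theorem absolutelyContinuousOnInterval_complex_integral {f : ℝ → ℂ} {a b c : ℝ}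
    (h : IntervalIntegrable f volume a b) (hc : c ∈ uIcc a b) :
    AbsolutelyContinuousOnInterval (fun x => ∫ t in c..x, f t) a b := by
  have hre : IntervalIntegrable (fun t => (f t).re) volume a b :=
    ⟨h.1.re, h.2.re⟩
  have him : IntervalIntegrable (fun t => (f t).im) volume a b :=
    ⟨h.1.im, h.2.im⟩
  have h1 := (absolutelyContinuousOnInterval_ofReal
    (hre.absolutelyContinuousOnInterval_intervalIntegral hc)).fun_add
    ((absolutelyContinuousOnInterval_ofReal
      (him.absolutelyContinuousOnInterval_intervalIntegral hc)).const_smul Complex.I)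
  -- Both sides agree on `uIcc a b`, and only the values there matter.
  have h2 : ∀ x ∈ uIcc a b, ∫ t in c..x, f t =
      ((∫ t in c..x, (f t).re : ℝ) : ℂ) + Complex.I • ((∫ t in c..x, (f t).im : ℝ) : ℂ) := by
    intro x hx
    have hi : IntervalIntegrable f volume c x := h.mono_set (uIcc_subset_uIcc hc hx)
    rw [← intervalIntegral.integral_ofReal, ← intervalIntegral.integral_ofReal,
      smul_eq_mul, ← intervalIntegral.integral_const_mul, ← intervalIntegral.integral_add]
    · refine intervalIntegral.integral_congr fun t _ => ?_
      rw [mul_comm]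
      exact (Complex.re_add_im _).symm
    · exact ⟨hi.1.re.ofReal, hi.2.re.ofReal⟩
    · exact ⟨hi.1.im.ofReal.const_mul _, hi.2.im.ofReal.const_mul _⟩
  rw [absolutelyContinuousOnInterval_iff] at h1 ⊢
  intro ε hε
  obtain ⟨δ, hδ, H⟩ := h1 ε hε
  refine ⟨δ, hδ, fun E hE hEd => ?_⟩
  have := H E hE hEd
  rwa [Finset.sum_congr rfl fun i hi => by
    rw [← h2 _ (hE.1 i hi).1, ← h2 _ (hE.1 i hi).2]] at this

/-- `u'` is locally integrable on `]0, ∞[` and `u` is a primitive of it there, so that `u` is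
locally absolutely continuous with almost everywhere derivative `u'`. -/
def IsPrimitive (u u' : ℝ → ℂ) : Prop :=
  ∀ a b : ℝ, 0 < a → 0 < b → IntervalIntegrable u' volume a b ∧ u b - u a = ∫ x in a..b, u' x

theorem pos_of_mem_uIcc {a b x : ℝ} (ha : 0 < a) (hb : 0 < b) (hx : x ∈ uIcc a b) : 0 < x :=
  lt_of_lt_of_le (lt_min ha hb) hx.1

theorem uIcc_subset_Ioi_zero {a b : ℝ} (ha : 0 < a) (hb : 0 < b) : uIcc a b ⊆ Ioi 0 :=
  fun _ hx => pos_of_mem_uIcc ha hb hx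

namespace IsPrimitive

variable {u u' v v' : ℝ → ℂ}

theorem absolutelyContinuousOnInterval (h : IsPrimitive u u') {a b : ℝ} (ha : 0 < a)
    (hb : 0 < b) : AbsolutelyContinuousOnInterval u a b := by
  have h1 := absolutelyContinuousOnInterval_complex_integral (h a b ha hb).1
    (left_mem_uIcc : a ∈ uIcc a b)
  rw [absolutelyContinuousOnInterval_iff] at h1 ⊢
  intro ε hε
  obtain ⟨δ, hδ, H⟩ := h1 ε hε
  refine ⟨δ, hδ, fun E hE hEd => ?_⟩
  have := H E hE hEd
  rwa [Finset.sum_congr rfl fun i hi => by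
    rw [← (h a _ ha (pos_of_mem_uIcc ha hb (hE.1 i hi).1)).2,
      ← (h a _ ha (pos_of_mem_uIcc ha hb (hE.1 i hi).2)).2, dist_sub_right]] at this

theorem continuousAt (h : IsPrimitive u u') {x : ℝ} (hx : 0 < x) : ContinuousAt u x := by
  have h1 := (h.absolutelyContinuousOnInterval (a := x / 2) (b := x + 1) (by linarith)
    (by linarith)).continuousOn
  refine h1.continuousAt ?_
  rw [uIcc_of_le (by linarith)]
  exact Icc_mem_nhds (by linarith) (by linarith)

theorem continuousOn (h : IsPrimitive u u') : ContinuousOn u (Ioi 0) :=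
  fun _ hx => (h.continuousAt hx).continuousWithinAt

theorem ae_hasDerivAt (h : IsPrimitive u u') {a b : ℝ} (ha : 0 < a) (hb : 0 < b) :
    ∀ᵐ x, x ∈ uIcc a b → HasDerivAt u (u' x) x := by
  filter_upwards [(h a b ha hb).1.ae_hasDerivAt_integral] with x hx hxab
  have h1 := (hx hxab a left_mem_uIcc).add_const (u a)
  refine h1.congr_of_eventuallyEq ?_
  filter_upwards [Ioi_mem_nhds (pos_of_mem_uIcc ha hb hxab)] with y hy
  rw [← (h a y ha hy).2]
  ring

theorem hasDerivAt (h : IsPrimitive u u') (hc : ContinuousOn u' (Ioi 0)) {x : ℝ} (hx : 0 < x) :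
    HasDerivAt u (u' x) x := by
  have hcx : ContinuousAt u' x := hc.continuousAt (Ioi_mem_nhds hx)
  have h1 := (intervalIntegral.integral_hasDerivAt_right (h x x hx hx).1
    (hc.stronglyMeasurableAtFilter isOpen_Ioi x hx) hcx).add_const (u x)
  refine h1.congr_of_eventuallyEq ?_
  filter_upwards [Ioi_mem_nhds hx] with y hy
  rw [← (h x y hx hy).2]
  ring

theorem of_hasDerivAt (h : ∀ x, 0 < x → HasDerivAt u (u' x) x) (hc : ContinuousOn u' (Ioi 0)) :
    IsPrimitive u u' := by
  intro a b ha hb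
  have hi : IntervalIntegrable u' volume a b :=
    (hc.mono (uIcc_subset_Ioi_zero ha hb)).intervalIntegrable
  exact ⟨hi, (intervalIntegral.integral_eq_sub_of_hasDerivAt
    (fun x hx => h x (pos_of_mem_uIcc ha hb hx)) hi).symm⟩

theorem congr_ae (h : IsPrimitive u u') (hv : u' =ᵐ[vol] v') : IsPrimitive u v' := by
  intro a b ha hb
  have h0 : ∀ᵐ x, x ∈ uIoc a b → u' x = v' x := by
    filter_upwards [(ae_restrict_iff' measurableSet_Ioi).1 hv] with x hx hxab
    exact hx (pos_of_mem_uIcc ha hb (uIoc_subset_uIcc hxab))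
  have h1 := h a b ha hb
  refine ⟨h1.1.congr_ae ((ae_restrict_iff' measurableSet_uIoc).2 h0), h1.2.trans ?_⟩
  exact intervalIntegral.integral_congr_ae h0

theorem congr (h : IsPrimitive u u') (hu : ∀ x, 0 < x → u x = v x)
    (hv : ∀ x, 0 < x → u' x = v' x) : IsPrimitive v v' := by
  have h1 : IsPrimitive u v' := h.congr_ae
    ((ae_restrict_iff' measurableSet_Ioi).2 (Eventually.of_forall fun x hx => hv x hx))
  intro a b ha hb
  rw [← hu a ha, ← hu b hb]
  exact h1 a b ha hb

theorem add (hu : IsPrimitive u u') (hv : IsPrimitive v v') :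
    IsPrimitive (fun x => u x + v x) (fun x => u' x + v' x) := by
  intro a b ha hb
  refine ⟨(hu a b ha hb).1.add (hv a b ha hb).1, ?_⟩
  rw [intervalIntegral.integral_add (hu a b ha hb).1 (hv a b ha hb).1, ← (hu a b ha hb).2,
    ← (hv a b ha hb).2]
  ring

theorem const_mul (c : ℂ) (hu : IsPrimitive u u') :
    IsPrimitive (fun x => c * u x) (fun x => c * u' x) := by
  intro a b ha hb
  refine ⟨(hu a b ha hb).1.const_mul c, ?_⟩
  rw [intervalIntegral.integral_const_mul, ← (hu a b ha hb).2]
  ring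

theorem complexConj (hu : IsPrimitive u u') :
    IsPrimitive (fun x => conj (u x)) (fun x => conj (u' x)) := by
  intro a b ha hb
  have h := hu a b ha hb
  refine ⟨⟨?_, ?_⟩, ?_⟩
  · exact (Complex.conjLIE.toContinuousLinearEquiv.integrable_comp_iff (φ := u')).2 h.1.1
  · exact (Complex.conjLIE.toContinuousLinearEquiv.integrable_comp_iff (φ := u')).2 h.1.2
  · rw [← map_sub, h.2, intervalIntegral, intervalIntegral, map_sub, integral_conj, integral_conj]

/-- The product rule for locally absolutely continuous functions. -/
theorem mul (hu : IsPrimitive u u') (hv : IsPrimitive v v') :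
    IsPrimitive (fun x => u x * v x) (fun x => u' x * v x + u x * v' x) := by
  intro a b ha hb
  have acu := hu.absolutelyContinuousOnInterval ha hb
  have acv := hv.absolutelyContinuousOnInterval ha hb
  have hi : IntervalIntegrable (fun x => u' x * v x + u x * v' x) volume a b :=
    ((hu a b ha hb).1.mul_continuousOn acv.continuousOn).add
      ((hv a b ha hb).1.continuousOn_mul acu.continuousOn)
  refine ⟨hi, ?_⟩
  have ac := (acu.fun_smul acv).fun_sub
    (absolutelyContinuousOnInterval_complex_integral hi (left_mem_uIcc : a ∈ uIcc a b))
  obtain ⟨C, hC⟩ := ac.const_of_ae_hasDerivAt_zero (by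
    filter_upwards [hu.ae_hasDerivAt ha hb, hv.ae_hasDerivAt ha hb, hi.ae_hasDerivAt_integral]
      with x h1 h2 h3 hx
    have h4 := ((h1 hx).mul (h2 hx)).sub (h3 hx a left_mem_uIcc)
    rw [sub_self] at h4
    exact h4)
  have ea := hC a left_mem_uIcc
  have eb := hC b right_mem_uIcc
  simp only [smul_eq_mul, intervalIntegral.integral_same, sub_zero] at ea eb
  beta_reduce
  rw [ea, ← eb]
  ring

/-- A primitive of a function that is integrable at the origin converges there. -/
theorem tendsto_zero (hu : IsPrimitive u u') (hi : IntegrableOn u' (Ioc 0 1)) :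
    Tendsto u (𝓝[>] 0) (𝓝 (u 1 - ∫ x in Ioc 0 1, u' x)) := by
  have h1 := intervalIntegral.continuousOn_primitive_interval_left (μ := volume) (f := u')
    (a := 0) (b := 1)
    (by rwa [uIcc_of_le zero_le_one, integrableOn_Icc_iff_integrableOn_Ioc])
  have h2 : Tendsto (fun x => ∫ t in x..1, u' t) (𝓝[>] 0) (𝓝 (∫ t in (0 : ℝ)..1, u' t)) := by
    have := h1 0 left_mem_uIcc
    rw [uIcc_of_le zero_le_one] at this
    refine this.mono_left ?_
    rw [← nhdsWithin_Ioc_eq_nhdsGT (zero_lt_one : (0 : ℝ) < 1)]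
    exact nhdsWithin_mono _ Ioc_subset_Icc_self
  rw [← intervalIntegral.integral_of_le zero_le_one]
  refine (tendsto_const_nhds.sub h2).congr' ?_
  filter_upwards [self_mem_nhdsWithin] with x hx
  rw [← (hu x 1 hx one_pos).2]
  ring

/-- A primitive of a function that is integrable at infinity converges there. -/
theorem tendsto_atTop (hu : IsPrimitive u u') (hi : IntegrableOn u' (Ioi 1)) :
    Tendsto u atTop (𝓝 (u 1 + ∫ x in Ioi 1, u' x)) := by
  refine (tendsto_const_nhds.add
    (intervalIntegral_tendsto_integral_Ioi 1 hi tendsto_id)).congr' ?_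
  filter_upwards [eventually_gt_atTop 0] with x hx
  rw [id, ← (hu 1 x one_pos hx).2]
  ring

end IsPrimitive

/-- Every locally integrable function on the half-line has a primitive. -/
theorem isPrimitive_integral {u' : ℝ → ℂ}
    (h : ∀ a b : ℝ, 0 < a → 0 < b → IntervalIntegrable u' volume a b) :
    IsPrimitive (fun x => ∫ t in (1 : ℝ)..x, u' t) u' := fun a b ha hb =>
  ⟨h a b ha hb, intervalIntegral.integral_interval_sub_left (h 1 b one_pos hb) (h 1 a one_pos ha)⟩

/-! ### The equation as a first-order system -/

/-- The solution `x^(1/2 - m)` of the homogeneous equation, as a complex-valued function. -/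
def pw (m x : ℝ) : ℂ := ((x ^ (1 / 2 - m) : ℝ) : ℂ)

theorem pw_ne_zero (m : ℝ) {x : ℝ} (hx : 0 < x) : pw m x ≠ 0 :=
  Complex.ofReal_ne_zero.2 (Real.rpow_pos_of_pos hx _).ne'

theorem conj_pw (m x : ℝ) : conj (pw m x) = pw m x := Complex.conj_ofReal _

theorem hasDerivAt_pw (m : ℝ) {x : ℝ} (hx : 0 < x) :
    HasDerivAt (pw m) ((1 / 2 - m) * pw m x / x) x := by
  have h := (Real.hasDerivAt_rpow_const (p := 1 / 2 - m) (Or.inl hx.ne')).ofReal_comp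
  have hx' : (x : ℂ) ≠ 0 := Complex.ofReal_ne_zero.2 hx.ne'
  refine h.congr_deriv ?_
  rw [Real.rpow_sub_one hx.ne', pw]
  push_cast
  ring

theorem contDiffOn_pw (m : ℝ) : ContDiffOn ℝ ∞ (pw m) (Ioi 0) := by
  intro x hx
  have h : ContDiffAt ℝ ∞ (fun y : ℝ => y ^ (1 / 2 - m)) x :=
    Real.contDiffAt_rpow_const_of_ne (ne_of_gt hx)
  exact (Complex.ofRealCLM.contDiff.contDiffAt.comp x h).contDiffWithinAt

theorem continuousOn_pw (m : ℝ) : ContinuousOn (pw m) (Ioi 0) := (contDiffOn_pw m).continuousOn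

theorem continuousOn_pw_inv (m : ℝ) : ContinuousOn (fun x => (pw m x)⁻¹) (Ioi 0) :=
  (continuousOn_pw m).inv₀ fun _ hx => pw_ne_zero m hx

theorem pw_sq (m : ℝ) {x : ℝ} (hx : 0 < x) : pw m x ^ 2 = ((x ^ (1 - 2 * m) : ℝ) : ℂ) := by
  rw [pw, ← Complex.ofReal_pow, ← Real.rpow_natCast, ← Real.rpow_mul hx.le]
  norm_num
  ring_nf

theorem norm_pw_sq {m x : ℝ} (hx : 0 < x) : ‖pw m x‖ ^ 2 = x ^ (1 - 2 * m) := by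
  rw [← norm_pow, pw_sq m hx, Complex.norm_real,
    Real.norm_of_nonneg (Real.rpow_pos_of_pos hx _).le]

theorem pw_neg (m : ℝ) (x : ℝ) : pw (-m) x = ((x ^ (1 / 2 + m) : ℝ) : ℂ) := by
  rw [pw, sub_neg_eq_add]

theorem pw_neg_eq {m x : ℝ} (hx : 0 < x) : pw (-m) x = x / pw m x := by
  rw [eq_div_iff (pw_ne_zero m hx), pw_neg, pw, ← Complex.ofReal_mul, ← Real.rpow_add hx]
  norm_num

/-- The function `f = p u`, where `p = x^(1/2 - m)`, solves `-f'' + (m² - 1/4) x⁻² f = g` on the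
half-line, with quasi-derivative `K = p² u' = p (f' - (1/2 - m) f / x)`. -/
structure Sol (m : ℝ) (u K g : ℝ → ℂ) : Prop where
  du : IsPrimitive u fun x => K x / pw m x ^ 2
  dK : IsPrimitive K fun x => -(pw m x * g x)

namespace Sol

variable {m : ℝ} {u K g v P h : ℝ → ℂ}

theorem add (h₁ : Sol m u K g) (h₂ : Sol m v P h) :
    Sol m (fun x => u x + v x) (fun x => K x + P x) fun x => g x + h x :=
  ⟨(h₁.du.add h₂.du).congr (fun _ _ => rfl) fun _ _ => by ring,
    (h₁.dK.add h₂.dK).congr (fun _ _ => rfl) fun _ _ => by ring⟩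

theorem const_mul (c : ℂ) (h₁ : Sol m u K g) :
    Sol m (fun x => c * u x) (fun x => c * K x) fun x => c * g x :=
  ⟨(h₁.du.const_mul c).congr (fun _ _ => rfl) fun _ _ => by ring,
    (h₁.dK.const_mul c).congr (fun _ _ => rfl) fun _ _ => by ring⟩

theorem congr_ae (h₁ : Sol m u K g) (hg : g =ᵐ[vol] h) : Sol m u K h :=
  ⟨h₁.du, h₁.dK.congr_ae (by filter_upwards [hg] with x hx; rw [hx])⟩

theorem continuousOn_deriv (h₁ : Sol m u K g) :
    ContinuousOn (fun x => K x / pw m x ^ 2) (Ioi 0) :=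
  h₁.dK.continuousOn.div ((continuousOn_pw m).pow 2) fun _ hx => pow_ne_zero 2 (pw_ne_zero m hx)

theorem hasDerivAt (h₁ : Sol m u K g) {x : ℝ} (hx : 0 < x) :
    HasDerivAt u (K x / pw m x ^ 2) x :=
  h₁.du.hasDerivAt h₁.continuousOn_deriv hx

theorem hasDerivAt_pw_mul (h₁ : Sol m u K g) {x : ℝ} (hx : 0 < x) :
    HasDerivAt (fun y => pw m y * u y) ((1 / 2 - m) * pw m x / x * u x + K x / pw m x) x := by
  convert! (hasDerivAt_pw m hx).mul (h₁.hasDerivAt hx) using 1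
  have := pw_ne_zero m hx
  field_simp

/-- A twice differentiable function gives a solution of the first-order system. -/
theorem of_hasDerivAt {F F' F'' : ℝ → ℂ} (h₁ : ∀ x, 0 < x → HasDerivAt F (F' x) x)
    (h₂ : ∀ x, 0 < x → HasDerivAt F' (F'' x) x) (hc : ContinuousOn F'' (Ioi 0))
    (hg : ∀ x, 0 < x → g x = -F'' x + (((m ^ 2 - 1 / 4) / x ^ 2 : ℝ) : ℂ) * F x) :
    Sol m (fun x => F x / pw m x) (fun x => pw m x * F' x - (1 / 2 - m) * pw m x / x * F x) g := by
  have cF : ContinuousOn F (Ioi 0) := fun x hx => (h₁ x hx).continuousAt.continuousWithinAt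
  have cF' : ContinuousOn F' (Ioi 0) := fun x hx => (h₂ x hx).continuousAt.continuousWithinAt
  have cx : ContinuousOn (fun x : ℝ => (x : ℂ)) (Ioi 0) := Complex.continuous_ofReal.continuousOn
  have hx0 : ∀ x ∈ Ioi (0 : ℝ), (x : ℂ) ≠ 0 := fun x hx => Complex.ofReal_ne_zero.2 (ne_of_gt hx)
  have cK : ContinuousOn (fun x : ℝ => pw m x * F' x - (1 / 2 - m) * pw m x / x * F x) (Ioi 0) :=
    ((continuousOn_pw m).mul cF').sub (((continuousOn_const.mul (continuousOn_pw m)).div cx hx0).mul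
      cF)
  have cg : ContinuousOn g (Ioi 0) := by
    refine ContinuousOn.congr (f := fun x => -F'' x + ((m : ℂ) ^ 2 - 1 / 4) / (x : ℂ) ^ 2 * F x)
      (hc.neg.add ((continuousOn_const.div (cx.pow 2) fun x hx => pow_ne_zero 2 (hx0 x hx)).mul cF))
      fun x hx => ?_
    rw [hg x hx]
    push_cast
    ring
  refine ⟨IsPrimitive.of_hasDerivAt (fun x hx => ?_) (cK.div ((continuousOn_pw m).pow 2)
      fun _ hx => pow_ne_zero 2 (pw_ne_zero m hx)),
    IsPrimitive.of_hasDerivAt (fun x hx => ?_) ((continuousOn_pw m).mul cg).neg⟩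
  · have hp := pw_ne_zero m hx
    refine ((h₁ x hx).div (hasDerivAt_pw m hx) hp).congr_deriv ?_
    have := hx0 x hx
    field_simp
  · have hp := hasDerivAt_pw m hx
    have hxx := (hasDerivAt_id x).ofReal_comp
    refine ((hp.mul (h₂ x hx)).sub ((((hp.const_mul (1 / 2 - m : ℂ)).div hxx (hx0 x hx))).mul
      (h₁ x hx))).congr_deriv ?_
    have := hx0 x hx
    rw [hg x hx]
    simp only [id, Pi.div_apply]
    push_cast
    field_simp
    ring

/-- Lagrange's identity. -/
theorem lagrange (h₁ : Sol m u K g) (h₂ : Sol m v P h) :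
    IsPrimitive (fun x => u x * P x - K x * v x)
      fun x => g x * (pw m x * v x) - pw m x * u x * h x := by
  refine ((h₁.du.mul h₂.dK).add ((h₁.dK.mul h₂.du).const_mul (-1))).congr
    (fun x _ => by ring) fun x hx => ?_
  have := pw_ne_zero m hx
  field_simp
  ring

end Sol

theorem exists_Ioo_of_isCompact {s : Set ℝ} (hs : IsCompact s) (h : s ⊆ Ioi 0) :
    ∃ δ R : ℝ, 0 < δ ∧ δ < R ∧ s ⊆ Ioo δ R := by
  rcases s.eq_empty_or_nonempty with rfl | hne
  · exact ⟨1, 2, by norm_num, by norm_num, empty_subset _⟩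
  · obtain ⟨a, ha⟩ := hs.exists_isLeast hne
    obtain ⟨b, hb⟩ := hs.exists_isGreatest hne
    have ha0 : 0 < a := h ha.1
    have hab : a ≤ b := ha.2 hb.1
    exact ⟨a / 2, b + 1, by linarith, by linarith, fun x hx =>
      ⟨by linarith [ha.2 hx], by linarith [hb.2 hx]⟩⟩

theorem tsupport_subset_Ioi (φ : Test) : tsupport (φ : ℝ → ℂ) ⊆ Ioi 0 := φ.tsupport_subset

theorem sol_test (m : ℝ) (φ : Test) : Sol m (fun x => φ x / pw m x)
    (fun x => pw m x * deriv φ x - (1 / 2 - m) * pw m x / x * φ x) (diffExpr m φ) := by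
  have h : ContDiff ℝ ∞ (φ : ℝ → ℂ) := φ.contDiff
  have h1 := contDiff_infty_iff_deriv.1 h
  have h2 := contDiff_infty_iff_deriv.1 h1.2
  exact Sol.of_hasDerivAt (fun x _ => (h1.1 x).hasDerivAt) (fun x _ => (h2.1 x).hasDerivAt)
    h2.2.continuous.continuousOn fun x _ => rfl

theorem diffExpr_eq_zero_of_notMem (m : ℝ) (φ : Test) {x : ℝ} (hx : x ∉ tsupport φ) :
    diffExpr m φ x = 0 := by
  have h1 : x ∉ tsupport (deriv φ) := fun h => hx (tsupport_deriv_subset h)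
  have h2 : x ∉ tsupport (deriv (deriv φ)) := fun h => h1 (tsupport_deriv_subset h)
  rw [diffExpr, image_eq_zero_of_notMem_tsupport hx, image_eq_zero_of_notMem_tsupport h2]
  simp

theorem integral_vol_eq_intervalIntegral {h : ℝ → ℂ} {δ R : ℝ} (hδ : 0 < δ) (hR : δ < R)
    (h0 : ∀ x ∉ Ioo δ R, h x = 0) : ∫ x, h x ∂vol = ∫ x in δ..R, h x := by
  rw [intervalIntegral.integral_of_le hR.le]
  refine (setIntegral_eq_of_subset_of_forall_sdiff_eq_zero measurableSet_Ioi
    (fun x hx => lt_trans hδ hx.1) fun x hx => h0 x fun hx' => hx.2 ⟨hx'.1, hx'.2.le⟩)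

/-- A solution of the first-order system is a distributional solution. -/
theorem Sol.integral_diffExpr {m : ℝ} {u K g : ℝ → ℂ} (hs : Sol m u K g) (φ : Test) :
    ∫ x, pw m x * u x * diffExpr m φ x ∂vol = ∫ x, g x * φ x ∂vol := by
  obtain ⟨δ, R, hδ, hR, hsub⟩ := exists_Ioo_of_isCompact φ.hasCompactSupport (tsupport_subset_Ioi φ)
  have hR0 : 0 < R := hδ.trans hR
  have hφ : ∀ x ∉ Ioo δ R, φ x = 0 := fun x hx =>
    image_eq_zero_of_notMem_tsupport fun h => hx (hsub h)
  have hφ' : ∀ x ∉ Ioo δ R, deriv φ x = 0 := fun x hx =>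
    image_eq_zero_of_notMem_tsupport fun h => hx (hsub (tsupport_deriv_subset h))
  have hL := (hs.lagrange (sol_test m φ)) δ R hδ hR0
  have i1 : IntervalIntegrable (fun x => pw m x * u x * diffExpr m φ x) volume δ R :=
    ((((continuousOn_pw m).mul hs.du.continuousOn).mul
      (continuous_diffExpr m φ).continuousOn).mono
        (uIcc_subset_Ioi_zero hδ hR0)).intervalIntegrable
  have hcongr : EqOn (fun x => g x * (pw m x * (φ x / pw m x)) - pw m x * u x * diffExpr m φ x)
      (fun x => g x * φ x - pw m x * u x * diffExpr m φ x) (uIcc δ R) := by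
    intro x hx
    have := pw_ne_zero m (pos_of_mem_uIcc hδ hR0 hx)
    simp only
    field_simp
  have i2 : IntervalIntegrable (fun x => g x * φ x) volume δ R := by
    refine ((hL.1.congr (hcongr.mono uIoc_subset_uIcc)).add i1).congr fun x _ => ?_
    simp
  rw [intervalIntegral.integral_congr hcongr, intervalIntegral.integral_sub i2 i1] at hL
  have hL2 := hL.2
  simp only [hφ δ (by simp), hφ R (by simp), hφ' δ (by simp), hφ' R (by simp), mul_zero, zero_div,
    sub_zero] at hL2
  rw [integral_vol_eq_intervalIntegral hδ hR, integral_vol_eq_intervalIntegral hδ hR]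
  · exact (sub_eq_zero.1 hL2.symm).symm
  · intro x hx
    rw [hφ x hx, mul_zero]
  · intro x hx
    rw [diffExpr_eq_zero_of_notMem m φ fun h => hx (hsub h), mul_zero]

/-! ### Regularity of distributional solutions -/

/-- Local integrability on the open half-line. -/
def LocInt (k : ℝ → ℂ) : Prop := ∀ a b : ℝ, 0 < a → 0 < b → IntervalIntegrable k volume a b

theorem locInt_of_continuousOn {k : ℝ → ℂ} (h : ContinuousOn k (Ioi 0)) : LocInt k :=
  fun _ _ ha hb => (h.mono (uIcc_subset_Ioi_zero ha hb)).intervalIntegrable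

theorem LocInt.continuousOn_mul {k p : ℝ → ℂ} (h : LocInt k) (hp : ContinuousOn p (Ioi 0)) :
    LocInt fun x => p x * k x :=
  fun a b ha hb => (h a b ha hb).continuousOn_mul (hp.mono (uIcc_subset_Ioi_zero ha hb))

theorem LocInt.sub {k l : ℝ → ℂ} (h : LocInt k) (hl : LocInt l) : LocInt fun x => k x - l x :=
  fun a b ha hb => (h a b ha hb).sub (hl a b ha hb)

theorem locInt_L2 (f : L2) : LocInt f := by
  intro a b ha hb
  have h := (Lp.memLp f).restrict (uIoc a b)
  rw [Measure.restrict_restrict measurableSet_uIoc,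
    inter_eq_left.2 (uIoc_subset_uIcc.trans (uIcc_subset_Ioi_zero ha hb))] at h
  have : IsFiniteMeasure (volume.restrict (uIoc a b)) := ⟨by simp [uIoc]⟩
  exact intervalIntegrable_iff.2 (h.integrable (by norm_num))

theorem LocInt.locallyIntegrableOn {k : ℝ → ℂ} (h : LocInt k) :
    LocallyIntegrableOn k (Ioi 0) volume := by
  intro x hx
  have hx : (0 : ℝ) < x := hx
  refine ⟨Ioc (x / 2) (x + 1), mem_nhdsWithin_of_mem_nhds (Ioc_mem_nhds (by linarith)
    (by linarith)), ?_⟩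
  exact (intervalIntegrable_iff_integrableOn_Ioc_of_le (by linarith)).1
    (h (x / 2) (x + 1) (by linarith) (by linarith))

theorem exists_Ioo_test (φ : Test) :
    ∃ δ R : ℝ, 0 < δ ∧ δ < R ∧ ∀ x ∉ Ioo δ R, φ x = 0 := by
  obtain ⟨δ, R, hδ, hR, hsub⟩ := exists_Ioo_of_isCompact φ.hasCompactSupport (tsupport_subset_Ioi φ)
  exact ⟨δ, R, hδ, hR, fun x hx => image_eq_zero_of_notMem_tsupport fun h => hx (hsub h)⟩

theorem LocInt.integrable_mul_test {k : ℝ → ℂ} (h : LocInt k) (φ : Test) :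
    Integrable (fun x => k x * φ x) vol := by
  obtain ⟨δ, R, hδ, hR, h0⟩ := exists_Ioo_test φ
  have h1 := (h δ R hδ (hδ.trans hR)).mul_continuousOn φ.continuous.continuousOn
  rw [intervalIntegrable_iff_integrableOn_Ioc_of_le hR.le] at h1
  refine (h1.integrable_of_forall_notMem_eq_zero fun x hx => ?_).restrict
  rw [h0 x fun hx' => hx ⟨hx'.1, hx'.2.le⟩, mul_zero]

/-- The distribution with locally integrable density `k`. -/
def pairing (k : ℝ → ℂ) (hk : LocInt k) : Test →ₗ[ℂ] ℂ where
  toFun φ := ∫ x, k x * φ x ∂vol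
  map_add' φ ψ := by
    rw [← integral_add (hk.integrable_mul_test φ) (hk.integrable_mul_test ψ)]
    refine integral_congr_ae (Eventually.of_forall fun x => ?_)
    exact mul_add _ _ _
  map_smul' c φ := by
    rw [RingHom.id_apply, smul_eq_mul, ← integral_const_mul]
    refine integral_congr_ae (Eventually.of_forall fun x => ?_)
    exact mul_left_comm _ _ _

theorem LocInt.ae_eq_zero {k : ℝ → ℂ} (hk : LocInt k)
    (h : ∀ φ : Test, ∫ x, k x * φ x ∂vol = 0) : k =ᵐ[vol] 0 := by
  have key := isOpen_Ioi.ae_eq_zero_of_integral_contDiff_smul_eq_zero hk.locallyIntegrableOn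
    (fun g hg hc hs => by
      let φ : Test := ⟨fun x => (g x : ℂ), Complex.ofRealCLM.contDiff.comp hg,
        hc.comp_left (g := fun t : ℝ => (t : ℂ)) Complex.ofReal_zero,
        (closure_mono (Function.support_comp_subset (g := fun t : ℝ => (t : ℂ))
          Complex.ofReal_zero g)).trans hs⟩
      have h1 := h φ
      rw [← setIntegral_eq_integral_of_forall_compl_eq_zero (s := Ioi (0 : ℝ))]
      · rw [← h1]
        refine integral_congr_ae (Eventually.of_forall fun x => ?_)
        change (g x) • (k x) = k x * (g x : ℂ)
        rw [Complex.real_smul, mul_comm]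
      · intro x hx
        have : g x = 0 := image_eq_zero_of_notMem_tsupport fun h => hx (hs h)
        simp [this])
  exact (ae_restrict_iff' measurableSet_Ioi).2 key

theorem contDiffOn_of_hasDerivAt {F F' : ℝ → ℂ} (h : ∀ x, 0 < x → HasDerivAt F (F' x) x)
    (h' : ContDiffOn ℝ ∞ F' (Ioi 0)) : ContDiffOn ℝ ∞ F (Ioi 0) := by
  rw [contDiffOn_infty_iff_deriv_of_isOpen isOpen_Ioi]
  exact ⟨fun x hx => (h x hx).differentiableAt.differentiableWithinAt,
    h'.congr fun x hx => (h x hx).deriv⟩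

/-- The solution of the homogeneous equation of the form `p s` with `p² s' = 1`. -/
def auxS (m x : ℝ) : ℂ := ∫ t in (1 : ℝ)..x, 1 / pw m t ^ 2

theorem sol_auxS (m : ℝ) : Sol m (auxS m) (fun _ => 1) fun _ => 0 := by
  refine ⟨isPrimitive_integral (locInt_of_continuousOn (continuousOn_const.div
    ((continuousOn_pw m).pow 2) fun _ hx => pow_ne_zero 2 (pw_ne_zero m hx))), ?_⟩
  exact (IsPrimitive.of_hasDerivAt (fun x _ => hasDerivAt_const x (1 : ℂ))
    continuousOn_const).congr (fun _ _ => rfl) fun _ _ => by simp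

theorem sol_one (m : ℝ) : Sol m (fun _ => 1) (fun _ => 0) fun _ => 0 := by
  refine ⟨?_, ?_⟩
  · exact (IsPrimitive.of_hasDerivAt (fun x _ => hasDerivAt_const x (1 : ℂ))
      continuousOn_const).congr (fun _ _ => rfl) fun _ _ => by simp
  · exact (IsPrimitive.of_hasDerivAt (fun x _ => hasDerivAt_const x (0 : ℂ))
      continuousOn_const).congr (fun _ _ => rfl) fun _ _ => by simp

/-- A test function orthogonal to both solutions of the homogeneous equation is the image of a test
function: integrating the first-order system from the left of its support, the two orthogonality
relations say that the solution vanishes on the right of it. -/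
theorem exists_diffExpr_eq (m : ℝ) (ψ : Test) (h₁ : ∫ x, pw m x * ψ x ∂vol = 0)
    (h₂ : ∫ x, pw m x * auxS m x * ψ x ∂vol = 0) :
    ∃ φ : Test, ∀ x, 0 < x → diffExpr m φ x = ψ x := by
  obtain ⟨δ, R, hδ, hR, h0⟩ := exists_Ioo_test ψ
  have hR0 : 0 < R := hδ.trans hR
  have hψ : ContDiff ℝ ∞ (ψ : ℝ → ℂ) := ψ.contDiff
  have hψ0 : ContDiffOn ℝ ∞ (fun x => -(pw m x * ψ x)) (Ioi 0) :=
    ((contDiffOn_pw m).mul hψ.contDiffOn).neg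
  set P : ℝ → ℂ := fun x => ∫ t in δ..x, -(pw m t * ψ t) with hPdef
  have iP : IsPrimitive P fun x => -(pw m x * ψ x) := fun a b ha hb =>
    ⟨locInt_of_continuousOn hψ0.continuousOn a b ha hb, intervalIntegral.integral_interval_sub_left
      (locInt_of_continuousOn hψ0.continuousOn δ b hδ hb)
      (locInt_of_continuousOn hψ0.continuousOn δ a hδ ha)⟩
  have dP : ∀ x, 0 < x → HasDerivAt P (-(pw m x * ψ x)) x := fun x hx =>
    iP.hasDerivAt hψ0.continuousOn hx
  have cP : ContDiffOn ℝ ∞ P (Ioi 0) := contDiffOn_of_hasDerivAt dP hψ0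
  have cE' : ContDiffOn ℝ ∞ (fun x => P x / pw m x ^ 2) (Ioi 0) := by
    simp only [div_eq_mul_inv]
    exact cP.mul (((contDiffOn_pw m).pow 2).inv fun _ hx => pow_ne_zero 2 (pw_ne_zero m hx))
  set η : ℝ → ℂ := fun x => ∫ t in δ..x, P t / pw m t ^ 2 with hηdef
  have iη : IsPrimitive η fun x => P x / pw m x ^ 2 := fun a b ha hb =>
    ⟨locInt_of_continuousOn cE'.continuousOn a b ha hb, intervalIntegral.integral_interval_sub_left
      (locInt_of_continuousOn cE'.continuousOn δ b hδ hb)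
      (locInt_of_continuousOn cE'.continuousOn δ a hδ ha)⟩
  have dη : ∀ x, 0 < x → HasDerivAt η (P x / pw m x ^ 2) x := fun x hx =>
    iη.hasDerivAt cE'.continuousOn hx
  have sη : Sol m η P ψ := ⟨iη, iP⟩
  have P_left : ∀ x ≤ δ, P x = 0 := by
    intro x hx
    refine intervalIntegral.integral_zero_ae (Eventually.of_forall fun t ht => ?_)
    rw [uIoc_of_ge hx] at ht
    rw [h0 t fun h => absurd h.1 (not_lt.2 ht.2), mul_zero, neg_zero]
  have η_left : ∀ x ≤ δ, η x = 0 := by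
    intro x hx
    refine intervalIntegral.integral_zero_ae (Eventually.of_forall fun t ht => ?_)
    rw [uIoc_of_ge hx] at ht
    rw [P_left t ht.2, zero_div]
  have P_right : ∀ x, R ≤ x → P x = 0 := by
    intro x hx
    have e1 : P R = 0 := by
      rw [hPdef]
      simp only
      rw [intervalIntegral.integral_neg, ← integral_vol_eq_intervalIntegral hδ hR, h₁, neg_zero]
      intro x hx
      rw [h0 x hx, mul_zero]
    have e2 := (iP R x hR0 (hR0.trans_le hx)).2
    rw [e1, sub_zero] at e2
    rw [e2]
    refine intervalIntegral.integral_zero_ae (Eventually.of_forall fun t ht => ?_)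
    rw [uIoc_of_le hx] at ht
    rw [h0 t fun h => absurd h.2 (not_lt.2 ht.1.le), mul_zero, neg_zero]
  have η_right : ∀ x, R ≤ x → η x = 0 := by
    intro x hx
    have e1 : η R = 0 := by
      have hl := (sη.lagrange (sol_auxS m) δ R hδ hR0).2
      rw [intervalIntegral.integral_congr (g := fun x => pw m x * auxS m x * ψ x)
        (fun t _ => by simp only; ring), ← integral_vol_eq_intervalIntegral hδ hR, h₂] at hl
      · simpa [P_left δ le_rfl, P_right R le_rfl, η_left δ le_rfl] using hl
      · intro x hx
        rw [h0 x hx, mul_zero]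
    have e2 := (iη R x hR0 (hR0.trans_le hx)).2
    rw [e1, sub_zero] at e2
    rw [e2]
    refine intervalIntegral.integral_zero_ae (Eventually.of_forall fun t ht => ?_)
    rw [uIoc_of_le hx] at ht
    rw [P_right t ht.1.le, zero_div]
  have cη : ContDiffOn ℝ ∞ η (Ioi 0) := contDiffOn_of_hasDerivAt dη cE'
  have hsupp : tsupport (fun x => pw m x * η x) ⊆ Icc δ R := by
    refine closure_minimal (fun x hx => ?_) isClosed_Icc
    by_contra hx'
    refine hx ?_
    rcases not_and_or.1 hx' with h | h
    · simp only [η_left x (not_le.1 h).le, mul_zero]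
    · simp only [η_right x (not_le.1 h).le, mul_zero]
  have hφ : ContDiff ℝ ∞ fun x => pw m x * η x := by
    rw [contDiff_iff_contDiffAt]
    intro x
    rcases lt_or_ge 0 x with hx | hx
    · exact ((contDiffOn_pw m).mul cη).contDiffAt (Ioi_mem_nhds hx)
    · refine (contDiffAt_const (c := (0 : ℂ))).congr_of_eventuallyEq ?_
      filter_upwards [Iio_mem_nhds (lt_of_le_of_lt hx hδ)] with y hy
      rw [η_left y (le_of_lt hy), mul_zero]
  refine ⟨⟨fun x => pw m x * η x, hφ, HasCompactSupport.of_support_subset_isCompact isCompact_Icc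
    (subset_closure.trans hsupp), hsupp.trans fun x hx => lt_of_lt_of_le hδ hx.1⟩, fun x hx => ?_⟩
  have d1 : ∀ y, 0 < y → HasDerivAt (fun y => pw m y * η y)
      ((1 / 2 - m) / y * (pw m y * η y) + P y / pw m y) y := fun y hy =>
    (sη.hasDerivAt_pw_mul hy).congr_deriv (by ring)
  have hx0 : (x : ℂ) ≠ 0 := Complex.ofReal_ne_zero.2 hx.ne'
  have hp := pw_ne_zero m hx
  have d2 : HasDerivAt (deriv fun y => pw m y * η y)
      (((m : ℂ) ^ 2 - 1 / 4) / x ^ 2 * (pw m x * η x) - ψ x) x := by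
    have hc : HasDerivAt (fun y : ℝ => (1 / 2 - m : ℂ) / y) (-(1 / 2 - m : ℂ) / x ^ 2) x := by
      refine ((hasDerivAt_const x (1 / 2 - m : ℂ)).div (hasDerivAt_id x).ofReal_comp hx0).congr_deriv
        ?_
      simp
    have := ((hc.mul (d1 x hx)).add ((dP x hx).div (hasDerivAt_pw m hx) hp)).congr_of_eventuallyEq
      (f₁ := deriv fun y => pw m y * η y) (by
        filter_upwards [Ioi_mem_nhds hx] with y hy
        rw [(d1 y hy).deriv]
        rfl)
    refine this.congr_deriv ?_
    field_simp
    ring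
  change -deriv (deriv fun y => pw m y * η y) x + _ * (pw m x * η x) = ψ x
  rw [d2.deriv]
  push_cast
  ring

/-- Weyl's lemma: every distributional solution comes from the first-order system. Subtracting a
particular solution leaves a distribution annihilated by the adjoint equation, hence vanishing on
the common kernel of the two homogeneous solutions, hence a combination of these. -/
theorem exists_sol {m : ℝ} {f g : L2} (h : (f, g) ∈ maxGraph m) :
    ∃ u K : ℝ → ℂ, Sol m u K g ∧ f =ᵐ[vol] fun x => pw m x * u x := by
  have hg : LocInt fun x => -(pw m x * g x) := fun a b ha hb =>
    ((locInt_L2 g).continuousOn_mul (continuousOn_pw m) a b ha hb).neg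
  have iK := isPrimitive_integral hg
  set K : ℝ → ℂ := fun x => ∫ t in (1 : ℝ)..x, -(pw m t * g t)
  have cu : ContinuousOn (fun x => K x / pw m x ^ 2) (Ioi 0) :=
    iK.continuousOn.div ((continuousOn_pw m).pow 2) fun _ hx => pow_ne_zero 2 (pw_ne_zero m hx)
  have iu := isPrimitive_integral (locInt_of_continuousOn cu)
  set u : ℝ → ℂ := fun x => ∫ t in (1 : ℝ)..x, K t / pw m t ^ 2
  have hs : Sol m u K g := ⟨iu, iK⟩
  have l0 : LocInt fun x => pw m x * u x :=
    locInt_of_continuousOn ((continuousOn_pw m).mul iu.continuousOn)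
  have l1 : LocInt (pw m) := locInt_of_continuousOn (continuousOn_pw m)
  have l2 : LocInt fun x => pw m x * auxS m x :=
    locInt_of_continuousOn ((continuousOn_pw m).mul (sol_auxS m).du.continuousOn)
  have l3 : LocInt fun x => f x - pw m x * u x := (locInt_L2 f).sub l0
  have hker : ⨅ i, LinearMap.ker ((![pairing _ l1, pairing _ l2] : Fin 2 → Test →ₗ[ℂ] ℂ) i) ≤
      LinearMap.ker (pairing _ l3) := by
    intro ψ hψ
    rw [Submodule.mem_iInf] at hψ
    obtain ⟨φ, hφ⟩ := exists_diffExpr_eq m ψ (hψ 0) (hψ 1)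
    have hφ' : ∀ᵐ x ∂vol, diffExpr m φ x = ψ x := (ae_restrict_iff' measurableSet_Ioi).2
      (Eventually.of_forall hφ)
    change ∫ x, (f x - pw m x * u x) * ψ x ∂vol = 0
    have e1 : ∫ x, f x * ψ x ∂vol = ∫ x, g x * φ x ∂vol := by
      rw [← h φ]
      exact integral_congr_ae (by filter_upwards [hφ'] with x hx; rw [hx])
    have e2 : ∫ x, pw m x * u x * ψ x ∂vol = ∫ x, g x * φ x ∂vol := by
      rw [← hs.integral_diffExpr φ]
      exact integral_congr_ae (by filter_upwards [hφ'] with x hx; rw [hx])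
    rw [← sub_eq_zero.2 (e1.trans e2.symm), ← integral_sub ((locInt_L2 f).integrable_mul_test ψ)
      (l0.integrable_mul_test ψ)]
    exact integral_congr_ae (Eventually.of_forall fun x => sub_mul _ _ _)
  obtain ⟨c, hc⟩ := (Submodule.mem_span_range_iff_exists_fun ℂ).1 (mem_span_of_iInf_ker_le_ker hker)
  rw [Fin.sum_univ_two] at hc
  refine ⟨fun x => u x + (c 0 * 1 + c 1 * auxS m x), fun x => K x + (c 0 * 0 + c 1 * 1),
    (hs.add (((sol_one m).const_mul (c 0)).add ((sol_auxS m).const_mul (c 1)))).congr_ae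
      (by simp), ?_⟩
  have l4 : LocInt fun x => c 0 * pw m x + c 1 * (pw m x * auxS m x) := fun a b ha hb =>
    ((l1 a b ha hb).const_mul _).add ((l2 a b ha hb).const_mul _)
  have key : (fun x => (f x - pw m x * u x) - (c 0 * pw m x + c 1 * (pw m x * auxS m x)))
      =ᵐ[vol] 0 := by
    refine (l3.sub l4).ae_eq_zero fun ψ => ?_
    have e : c 0 * ∫ x, pw m x * ψ x ∂vol + c 1 * ∫ x, pw m x * auxS m x * ψ x ∂vol =
        ∫ x, (f x - pw m x * u x) * ψ x ∂vol := DFunLike.congr_fun hc ψ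
    rw [← integral_const_mul, ← integral_const_mul, ← integral_add
      ((l1.integrable_mul_test ψ).const_mul _) ((l2.integrable_mul_test ψ).const_mul _)] at e
    rw [← sub_eq_zero.2 e.symm, ← integral_sub
      (g := fun x => c 0 * (pw m x * ψ x) + c 1 * (pw m x * auxS m x * ψ x))
      (l3.integrable_mul_test ψ) (((l1.integrable_mul_test ψ).const_mul _).add ((l2.integrable_mul_test ψ).const_mul _))]
    exact integral_congr_ae (Eventually.of_forall fun x => by simp only; ring)
  filter_upwards [key] with x hx
  have hx : f x - pw m x * u x - (c 0 * pw m x + c 1 * (pw m x * auxS m x)) = 0 := hx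
  linear_combination hx

/-! ### Behaviour of solutions at the origin and at infinity -/

theorem vol_restrict_Ioc : vol.restrict (Ioc 0 1) = volume.restrict (Ioc (0 : ℝ) 1) := by
  rw [Measure.restrict_restrict measurableSet_Ioc, inter_eq_left.2 fun x hx => hx.1]

theorem aestronglyMeasurable_vol {k : ℝ → ℂ} (h : ContinuousOn k (Ioi 0)) :
    AEStronglyMeasurable k vol :=
  h.aestronglyMeasurable measurableSet_Ioi

theorem memLp_pw_Ioc {m : ℝ} (hm1 : m < 1) (R : ℝ) :
    MemLp (pw m) 2 (volume.restrict (Ioc 0 R)) := by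
  have hmeas : AEStronglyMeasurable (pw m) (volume.restrict (Ioc 0 R)) :=
    ((continuousOn_pw m).mono fun x hx => hx.1).aestronglyMeasurable measurableSet_Ioc
  rw [memLp_two_iff_integrable_sq_norm hmeas]
  have h := (intervalIntegral.intervalIntegrable_rpow' (a := 0) (b := R) (r := 1 - 2 * m)
    (by linarith)).1
  refine h.congr_fun (fun x hx => ?_) measurableSet_Ioc
  rw [norm_pw_sq hx.1]

theorem memLp_inv_pw_Ioc {m : ℝ} (hm0 : 0 < m) :
    MemLp (fun x => (pw m x)⁻¹) 2 (volume.restrict (Ioc (0 : ℝ) 1)) := by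
  have hmeas : AEStronglyMeasurable (fun x => (pw m x)⁻¹) (volume.restrict (Ioc (0 : ℝ) 1)) :=
    ((continuousOn_pw_inv m).mono fun x hx => hx.1).aestronglyMeasurable measurableSet_Ioc
  rw [memLp_two_iff_integrable_sq_norm hmeas]
  have h := (intervalIntegral.intervalIntegrable_rpow' (a := 0) (b := 1) (r := 2 * m - 1)
    (by linarith)).1
  refine h.congr_fun (fun x hx => ?_) measurableSet_Ioc
  rw [norm_inv, inv_pow, norm_pw_sq hx.1, ← Real.rpow_neg hx.1.le, neg_sub]

theorem integrableOn_pw_mul {m : ℝ} (hm1 : m < 1) (g : L2) :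
    IntegrableOn (fun x => pw m x * g x) (Ioc 0 1) := by
  have h := (Lp.memLp g).restrict (Ioc 0 1)
  rw [vol_restrict_Ioc] at h
  exact (memLp_pw_Ioc hm1 1).integrable_mul h

theorem integrableOn_inv_pw_sq {m : ℝ} (hm0 : 0 < m) :
    IntegrableOn (fun x => (pw m x ^ 2)⁻¹) (Ioc 0 1) := by
  refine ((memLp_inv_pw_Ioc hm0).integrable_mul (memLp_inv_pw_Ioc hm0)).congr
    (Eventually.of_forall fun x => ?_)
  simp only [Pi.mul_apply]
  rw [sq, mul_inv]

namespace Sol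

variable {m : ℝ} {u K : ℝ → ℂ}

theorem exists_bound {g : L2} (hm1 : m < 1) (hs : Sol m u K g) :
    ∃ C, ∀ x ∈ Ioc (0 : ℝ) 1, ‖K x‖ ≤ C := by
  refine ⟨‖K 1‖ + ∫ x in Ioc (0 : ℝ) 1, ‖pw m x * g x‖, fun x hx => ?_⟩
  have h1 := (hs.dK x 1 hx.1 one_pos).2
  rw [intervalIntegral.integral_neg, intervalIntegral.integral_of_le hx.2] at h1
  have h2 : K x = K 1 + ∫ t in Ioc x 1, pw m t * g t := by linear_combination -h1
  rw [h2]
  refine (norm_add_le _ _).trans (add_le_add le_rfl ((norm_integral_le_integral_norm _).trans ?_))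
  exact setIntegral_mono_set (integrableOn_pw_mul hm1 g).norm
    (Eventually.of_forall fun _ => norm_nonneg _)
    (Ioc_subset_Ioc_left hx.1.le).eventuallyLE

theorem exists_tendsto_K {g : L2} (hm1 : m < 1) (hs : Sol m u K g) :
    ∃ b, Tendsto K (𝓝[>] 0) (𝓝 b) :=
  ⟨_, hs.dK.tendsto_zero (integrableOn_pw_mul hm1 g).neg⟩

theorem exists_tendsto_u {g : L2} (hm0 : 0 < m) (hm1 : m < 1) (hs : Sol m u K g) :
    ∃ a, Tendsto u (𝓝[>] 0) (𝓝 a) := by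
  obtain ⟨C, hC⟩ := hs.exists_bound hm1
  refine ⟨_, hs.du.tendsto_zero ?_⟩
  refine ((integrableOn_inv_pw_sq hm0).norm.const_mul C).mono'
    ((hs.continuousOn_deriv.mono fun x hx => hx.1).aestronglyMeasurable measurableSet_Ioc) ?_
  refine (ae_restrict_iff' measurableSet_Ioc).2 (Eventually.of_forall fun x hx => ?_)
  rw [div_eq_mul_inv, norm_mul]
  exact mul_le_mul_of_nonneg_right (hC x hx) (norm_nonneg _)

theorem continuousOn_div {g : ℝ → ℂ} (hs : Sol m u K g) :
    ContinuousOn (fun x => K x / pw m x) (Ioi 0) :=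
  hs.dK.continuousOn.div (continuousOn_pw m) fun _ hx => pw_ne_zero m hx

/-- The product rule behind the factorisation `L = A* A`, where `A f = K / p`. -/
theorem green {v P g h : ℝ → ℂ} (h₁ : Sol m u K g) (h₂ : Sol m v P h) :
    IsPrimitive (fun x => conj (u x) * P x)
      fun x => conj (K x / pw m x) * (P x / pw m x) - conj (pw m x * u x) * h x := by
  refine (h₁.du.complexConj.mul h₂.dK).congr (fun _ _ => rfl) fun x hx => ?_
  have := pw_ne_zero m hx
  simp only [map_div₀, map_pow, map_mul, conj_pw]
  field_simp
  ring

/-- If `Re (ū K)` is at least `1` near infinity, then `|u|² ≥ (x^(2m) - R^(2m)) / m`, so that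
`p u` is not square integrable. -/
theorem not_integrable_of_le {g : ℝ → ℂ} (hm0 : 0 < m) (hs : Sol m u K g) {R : ℝ} (hR : 0 < R)
    (h : ∀ x, R ≤ x → 1 ≤ (conj (u x) * K x).re) :
    ¬ IntegrableOn (fun x => ‖pw m x * u x‖ ^ 2) (Ioi 0) := by
  intro hi
  have hd : ∀ x, 0 < x → HasDerivAt (fun x => ‖u x‖ ^ 2 - x ^ (2 * m) / m)
      (2 * ((conj (u x) * K x).re * x ^ (2 * m - 1)) - 2 * x ^ (2 * m - 1)) x := by
    intro x hx
    have h1 := (hs.hasDerivAt hx).norm_sq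
    have h2 := (Real.hasDerivAt_rpow_const (p := 2 * m) (Or.inl hx.ne')).div_const m
    refine (h1.sub h2).congr_deriv ?_
    have e : ⟪u x, K x / pw m x ^ 2⟫_ℝ = (conj (u x) * K x).re * x ^ (2 * m - 1) := by
      rw [Complex.inner, pw_sq m hx, mul_comm _ (conj (u x)), ← mul_div_assoc,
        Complex.div_ofReal_re, div_eq_mul_inv, ← Real.rpow_neg hx.le, neg_sub]
    rw [e]
    field_simp
  have hmono : MonotoneOn (fun x => ‖u x‖ ^ 2 - x ^ (2 * m) / m) (Ici R) := by
    refine monotoneOn_of_deriv_nonneg (convex_Ici R)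
      (fun x hx => (hd x (hR.trans_le hx)).continuousAt.continuousWithinAt)
      (fun x hx => (hd x (hR.trans (interior_Ici (a := R) ▸ hx :
        x ∈ Ioi R))).differentiableAt.differentiableWithinAt) fun x hx => ?_
    rw [interior_Ici] at hx
    have hx0 : 0 < x := hR.trans hx
    rw [(hd x hx0).deriv]
    have h1 := h x (le_of_lt hx)
    have h2 : 0 < x ^ (2 * m - 1) := Real.rpow_pos_of_pos hx0 _
    nlinarith
  -- Beyond this point `R ^ (2 * m) ≤ x ^ (2 * m) / 2`.
  set S : ℝ := max 1 (2 ^ (1 / (2 * m)) * R)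
  have hlow : ∀ x ∈ Ioi S, 1 / (2 * m) ≤ ‖pw m x * u x‖ ^ 2 := by
    intro x hx
    have hx1 : 1 < x := lt_of_le_of_lt (le_max_left _ _) hx
    have hx0 : 0 < x := one_pos.trans hx1
    have hxS : 2 ^ (1 / (2 * m)) * R < x := lt_of_le_of_lt (le_max_right _ _) hx
    have h2 : (1 : ℝ) ≤ 2 ^ (1 / (2 * m)) := Real.one_le_rpow (by norm_num) (by positivity)
    have hxR : R ≤ x := by nlinarith
    have h3 := hmono (self_mem_Ici : R ∈ Ici R) hxR hxR
    simp only at h3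
    have h4 : 2 * R ^ (2 * m) ≤ x ^ (2 * m) := by
      have := Real.rpow_le_rpow (by positivity) hxS.le (by positivity : 0 ≤ 2 * m)
      rwa [Real.mul_rpow (by positivity) hR.le, ← Real.rpow_mul (by norm_num),
        one_div_mul_cancel (by positivity), Real.rpow_one] at this
    have h5 : x ^ (2 * m) / (2 * m) ≤ ‖u x‖ ^ 2 := by
      have h6 : R ^ (2 * m) / m ≤ x ^ (2 * m) / (2 * m) := by
        rw [div_le_div_iff₀ hm0 (by positivity)]
        nlinarith
      have h7 : x ^ (2 * m) / m = 2 * (x ^ (2 * m) / (2 * m)) := by field_simp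
      have h8 := sq_nonneg ‖u R‖
      linarith
    have h9 : ‖pw m x‖ ^ 2 * x ^ (2 * m) = x := by
      rw [norm_pw_sq hx0, ← Real.rpow_add hx0]
      norm_num
    rw [norm_mul, mul_pow]
    calc 1 / (2 * m) ≤ x / (2 * m) := by gcongr
      _ = ‖pw m x‖ ^ 2 * (x ^ (2 * m) / (2 * m)) := by rw [← mul_div_assoc, h9]
      _ ≤ _ := by gcongr
  have hS : 0 < S := lt_of_lt_of_le one_pos (le_max_left _ _)
  have hc : IntegrableOn (fun _ => 1 / (2 * m)) (Ioi S) := by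
    refine (hi.mono_set (Ioi_subset_Ioi hS.le)).mono' aestronglyMeasurable_const ?_
    refine (ae_restrict_iff' measurableSet_Ioi).2 (Eventually.of_forall fun x hx => ?_)
    rw [Real.norm_of_nonneg (by positivity)]
    exact hlow x hx
  rw [integrableOn_const_iff (by finiteness)] at hc
  simp [hm0.ne'] at hc

/-- The function `A f = K / p` is square integrable near infinity: otherwise `Re (ū K)`, whose
derivative is `|A f|² - Re (f̄ g)`, would tend to infinity. -/
theorem integrableOn_sq {f g : L2} (hm0 : 0 < m) (hs : Sol m u K g)
    (hf : f =ᵐ[vol] fun x => pw m x * u x) :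
    IntegrableOn (fun x => ‖K x / pw m x‖ ^ 2) (Ioi 1) := by
  have cw := hs.continuousOn_div
  have cw2 : ContinuousOn (fun x => ‖K x / pw m x‖ ^ 2) (Ioi 0) := cw.norm.pow 2
  have hloc : ∀ R, IntegrableOn (fun x => ‖K x / pw m x‖ ^ 2) (Ioc 1 R) := fun R =>
    ((cw2.mono fun x hx => one_pos.trans_le hx.1).integrableOn_Icc).mono_set Ioc_subset_Icc_self
  by_contra hnot
  have hpu : MemLp (fun x => pw m x * u x) 2 vol := (memLp_congr_ae hf).1 (Lp.memLp f)
  have hfg : Integrable (fun x => conj (pw m x * u x) * g x) vol := hpu.star.integrable_mul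
    (Lp.memLp g)
  set J : ℝ := ∫ x, ‖conj (pw m x * u x) * g x‖ ∂vol
  have hfreq : ∃ R₀, 1 ≤ R₀ ∧
      1 - (conj (u 1) * K 1).re + J < ∫ x in (1 : ℝ)..R₀, ‖K x / pw m x‖ ^ 2 := by
    by_contra! hcon
    refine hnot (integrableOn_Ioi_of_intervalIntegral_norm_bounded
      (1 - (conj (u 1) * K 1).re + J) 1 hloc tendsto_id ?_)
    filter_upwards [eventually_ge_atTop 1] with R hR
    simpa using hcon R hR
  obtain ⟨R₀, hR₀, hlt⟩ := hfreq
  refine hs.not_integrable_of_le hm0 (one_pos.trans_le hR₀) (fun x hx => ?_)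
    ((memLp_two_iff_integrable_sq_norm hpu.1).1 hpu)
  have hx1 : 1 ≤ x := hR₀.trans hx
  have hx0 : 0 < x := one_pos.trans_le hx1
  have i1 : IntervalIntegrable (fun x => ((‖K x / pw m x‖ ^ 2 : ℝ) : ℂ)) volume 1 x :=
    ((Complex.continuous_ofReal.comp_continuousOn cw2).mono
      (uIcc_subset_Ioi_zero one_pos hx0)).intervalIntegrable
  have i2 : IntervalIntegrable (fun x => conj (pw m x * u x) * g x) volume 1 x :=
    (intervalIntegrable_iff_integrableOn_Ioc_of_le hx1).2
      (IntegrableOn.mono_set (t := Ioi 0) hfg fun t ht => one_pos.trans ht.1)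
  have h1 := (hs.green hs 1 x one_pos hx0).2
  rw [intervalIntegral.integral_congr
    (g := fun x => ((‖K x / pw m x‖ ^ 2 : ℝ) : ℂ) - conj (pw m x * u x) * g x)
    (fun t _ => by
      simp only
      rw [Complex.conj_mul', Complex.ofReal_pow]),
    intervalIntegral.integral_sub i1 i2, intervalIntegral.integral_ofReal] at h1
  have h2 := congrArg Complex.re h1
  rw [Complex.sub_re, Complex.sub_re, Complex.ofReal_re] at h2
  have h3 : (∫ x in (1 : ℝ)..x, conj (pw m x * u x) * g x).re ≤ J := by
    refine (Complex.re_le_norm _).trans ?_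
    rw [intervalIntegral.integral_of_le hx1]
    refine (norm_integral_le_integral_norm _).trans ?_
    exact setIntegral_mono_set hfg.norm (Eventually.of_forall fun _ => norm_nonneg _)
      (show Ioc 1 x ⊆ Ioi 0 from fun t ht => one_pos.trans ht.1).eventuallyLE
  have h4 : ∫ x in (1 : ℝ)..R₀, ‖K x / pw m x‖ ^ 2 ≤ ∫ x in (1 : ℝ)..x, ‖K x / pw m x‖ ^ 2 := by
    rw [intervalIntegral.integral_of_le hR₀, intervalIntegral.integral_of_le hx1]
    exact setIntegral_mono_set (hloc x) (Eventually.of_forall fun _ => by positivity)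
      (Ioc_subset_Ioc_right hx).eventuallyLE
  linarith

theorem memLp_div {f g : L2} (hm0 : 0 < m) (hm1 : m < 1) (hs : Sol m u K g)
    (hf : f =ᵐ[vol] fun x => pw m x * u x) : MemLp (fun x => K x / pw m x) 2 vol := by
  have hmeas := aestronglyMeasurable_vol hs.continuousOn_div
  rw [memLp_two_iff_integrable_sq_norm hmeas]
  change IntegrableOn _ (Ioi (0 : ℝ)) volume
  rw [← Ioc_union_Ioi_eq_Ioi zero_le_one]
  refine IntegrableOn.union ?_ (hs.integrableOn_sq hm0 hf)
  have hmeas' : AEStronglyMeasurable (fun x => K x / pw m x) (volume.restrict (Ioc (0 : ℝ) 1)) :=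
    (hs.continuousOn_div.mono fun x hx => hx.1).aestronglyMeasurable measurableSet_Ioc
  obtain ⟨C, hC⟩ := hs.exists_bound hm1
  refine (memLp_two_iff_integrable_sq_norm hmeas').1 ?_
  refine (memLp_inv_pw_Ioc hm0).of_le_mul (c := C) hmeas' ?_
  refine (ae_restrict_iff' measurableSet_Ioc).2 (Eventually.of_forall fun x hx => ?_)
  rw [div_eq_mul_inv, norm_mul]
  exact mul_le_mul_of_nonneg_right (hC x hx) (norm_nonneg _)

end Sol

/-! ### Boundary data and Green's identity -/

/-- `(f, g)` belongs to the graph of the maximal operator, `w = f' - (1/2 - m) f / x`, and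
`f(x) = a x^(1/2 - m) + b x^(1/2 + m) + o(x^(1/2 + m))` at the origin. The expansion is encoded by
the limits of `u = f / p` and of `K = p² u'`, where `p = x^(1/2 - m)`: the function `x^(1/2 + m)`
has `K = 2 m`. -/
def BData (m : ℝ) (f g w : L2) (a b : ℂ) : Prop :=
  ∃ u K : ℝ → ℂ, Sol m u K g ∧ (f =ᵐ[vol] fun x => pw m x * u x) ∧
    (w =ᵐ[vol] fun x => K x / pw m x) ∧ Tendsto u (𝓝[>] 0) (𝓝 a) ∧
    Tendsto K (𝓝[>] 0) (𝓝 (2 * m * b))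

theorem exists_bData {m : ℝ} (hm0 : 0 < m) (hm1 : m < 1) {f g : L2} (h : (f, g) ∈ maxGraph m) :
    ∃ w a b, BData m f g w a b := by
  obtain ⟨u, K, hs, hf⟩ := exists_sol h
  obtain ⟨a, ha⟩ := hs.exists_tendsto_u hm0 hm1
  obtain ⟨b, hb⟩ := hs.exists_tendsto_K hm1
  have hw := hs.memLp_div hm0 hm1 hf
  have hm : (m : ℂ) ≠ 0 := Complex.ofReal_ne_zero.2 hm0.ne'
  exact ⟨hw.toLp _, a, b / (2 * m), u, K, hs, hf, hw.coeFn_toLp, ha, by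
    rwa [mul_div_cancel₀ _ (mul_ne_zero two_ne_zero hm)]⟩

namespace BData

variable {m : ℝ} {f g w f' g' w' : L2} {a b a' b' : ℂ}

theorem mem_maxGraph (h : BData m f g w a b) : (f, g) ∈ maxGraph m := by
  obtain ⟨u, K, hs, hf, -⟩ := h
  intro φ
  rw [← hs.integral_diffExpr φ]
  exact integral_congr_ae (by filter_upwards [hf] with x hx; rw [hx])

theorem add (h : BData m f g w a b) (h' : BData m f' g' w' a' b') :
    BData m (f + f') (g + g') (w + w') (a + a') (b + b') := by
  obtain ⟨u, K, hs, hf, hw, ha, hb⟩ := h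
  obtain ⟨u', K', hs', hf', hw', ha', hb'⟩ := h'
  refine ⟨_, _, (hs.add hs').congr_ae (Lp.coeFn_add g g').symm, ?_, ?_, ha.add ha', ?_⟩
  · filter_upwards [Lp.coeFn_add f f', hf, hf'] with x h1 h2 h3
    rw [h1, Pi.add_apply, h2, h3, mul_add]
  · filter_upwards [Lp.coeFn_add w w', hw, hw'] with x h1 h2 h3
    rw [h1, Pi.add_apply, h2, h3, add_div]
  · rw [mul_add]
    exact hb.add hb'

theorem smul (c : ℂ) (h : BData m f g w a b) :
    BData m (c • f) (c • g) (c • w) (c * a) (c * b) := by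
  obtain ⟨u, K, hs, hf, hw, ha, hb⟩ := h
  refine ⟨_, _, (hs.const_mul c).congr_ae ?_, ?_, ?_, ha.const_mul c, ?_⟩
  · filter_upwards [Lp.coeFn_smul c g] with x h1
    rw [h1, Pi.smul_apply, smul_eq_mul]
  · filter_upwards [Lp.coeFn_smul c f, hf] with x h1 h2
    rw [h1, Pi.smul_apply, h2, smul_eq_mul, mul_left_comm]
  · filter_upwards [Lp.coeFn_smul c w, hw] with x h1 h2
    rw [h1, Pi.smul_apply, h2, smul_eq_mul, mul_div_assoc]
  · rw [mul_left_comm]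
    exact hb.const_mul c

theorem sub (h : BData m f g w a b) (h' : BData m f' g' w' a' b') :
    BData m (f - f') (g - g') (w - w') (a - a') (b - b') := by
  have := h.add (h'.smul (-1))
  simpa only [neg_smul, one_smul, neg_mul, one_mul, ← sub_eq_add_neg] using this

/-- Green's identity, which expresses the factorisation `L = A* A` with `A f = w`: the product
`ū K` of two elements of the maximal domain tends to zero at infinity because it is integrable
there. -/
theorem inner_eq (h : BData m f g w a b) (h' : BData m f' g' w' a' b') :
    ⟪f, g'⟫_ℂ = ⟪w, w'⟫_ℂ + 2 * m * (conj a * b') := by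
  obtain ⟨u, K, hs, hf, hw, ha, hb⟩ := h
  obtain ⟨v, P, hs', hf', hw', ha', hb'⟩ := h'
  have h1 : (fun x => ⟪w x, w' x⟫_ℂ - ⟪f x, g' x⟫_ℂ) =ᵐ[vol]
      fun x => conj (K x / pw m x) * (P x / pw m x) - conj (pw m x * u x) * g' x := by
    filter_upwards [hf, hw, hw'] with x e1 e2 e3
    rw [RCLike.inner_apply', RCLike.inner_apply', e1, e2, e3]
  have i1 := L2.integrable_inner (𝕜 := ℂ) w w'
  have i2 := L2.integrable_inner (𝕜 := ℂ) f g'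
  have hi : IntegrableOn (fun x => conj (K x / pw m x) * (P x / pw m x) -
      conj (pw m x * u x) * g' x) (Ioi 0) := (i1.sub i2).congr h1
  have hG := hs.green hs'
  have t0 := hG.tendsto_zero (hi.mono_set fun x hx => hx.1)
  have t1 := hG.tendsto_atTop (hi.mono_set (Ioi_subset_Ioi zero_le_one))
  have e0 := tendsto_nhds_unique t0 ((Complex.continuous_conj.tendsto a).comp ha |>.mul hb')
  have e1 : conj (u 1) * P 1 + ∫ x in Ioi 1, conj (K x / pw m x) * (P x / pw m x) -
      conj (pw m x * u x) * g' x = 0 := by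
    refine IntegrableAtFilter.eq_zero_of_tendsto (μ := volume) ⟨Ioi 0, Ioi_mem_atTop 0, ?_⟩ ?_ t1
    · refine (L2.integrable_inner (𝕜 := ℂ) f w').congr ?_
      filter_upwards [hf, hw', self_mem_ae_restrict measurableSet_Ioi] with x e1 e2 hx
      have := pw_ne_zero m hx
      rw [RCLike.inner_apply', e1, e2, map_mul, conj_pw]
      field_simp
    · intro s hs
      obtain ⟨c, hc⟩ := mem_atTop_sets.1 hs
      rw [← top_le_iff, ← Real.volume_Ici (a := c)]
      exact measure_mono hc
  have e2 : ⟪w, w'⟫_ℂ - ⟪f, g'⟫_ℂ = ∫ x in Ioi 0, conj (K x / pw m x) * (P x / pw m x) -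
      conj (pw m x * u x) * g' x := by
    rw [L2.inner_def, L2.inner_def, ← integral_sub i1 i2]
    exact integral_congr_ae h1
  rw [← Ioc_union_Ioi_eq_Ioi zero_le_one, setIntegral_union Ioc_disjoint_Ioi_same measurableSet_Ioi
    (hi.mono_set fun x hx => hx.1) (hi.mono_set (Ioi_subset_Ioi zero_le_one))] at e2
  linear_combination -e2 - e1 + e0

theorem eq_zero (hm0 : 0 < m) (h : BData m 0 0 w a b) : w = 0 ∧ a = 0 ∧ b = 0 := by
  obtain ⟨u, K, hs, hf, hw, ha, hb⟩ := h
  have hae : u =ᵐ[vol] fun _ => 0 := by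
    filter_upwards [hf, Lp.coeFn_zero ℂ 2 vol, self_mem_ae_restrict measurableSet_Ioi]
      with x h1 h2 hx
    rw [h2, Pi.zero_apply] at h1
    exact (mul_eq_zero.1 h1.symm).resolve_left (pw_ne_zero m hx)
  have hu : EqOn u (fun _ => 0) (Ioi 0) :=
    Measure.eqOn_open_of_ae_eq hae isOpen_Ioi hs.du.continuousOn continuousOn_const
  have hK : ∀ x, 0 < x → K x = 0 := by
    intro x hx
    have h1 : HasDerivAt u 0 x := (hasDerivAt_const x (0 : ℂ)).congr_of_eventuallyEq
      (by filter_upwards [Ioi_mem_nhds hx] with y hy using hu hy)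
    have h2 := (hs.hasDerivAt hx).unique h1
    exact (div_eq_zero_iff.1 h2).resolve_right (pow_ne_zero 2 (pw_ne_zero m hx))
  have hm : (m : ℂ) ≠ 0 := Complex.ofReal_ne_zero.2 hm0.ne'
  refine ⟨Lp.ext ?_, ?_, ?_⟩
  · filter_upwards [hw, Lp.coeFn_zero ℂ 2 vol, self_mem_ae_restrict measurableSet_Ioi]
      with x h1 h2 hx
    rw [h1, h2, hK x hx, zero_div, Pi.zero_apply]
  · refine tendsto_nhds_unique ha (tendsto_const_nhds.congr' ?_)
    filter_upwards [self_mem_nhdsWithin] with x hx using (hu hx).symm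
  · have := tendsto_nhds_unique hb (tendsto_const_nhds.congr' (f₁ := fun _ => (0 : ℂ)) (by
      filter_upwards [self_mem_nhdsWithin] with x hx using (hK x hx).symm))
    exact (mul_eq_zero.1 this).resolve_left (mul_ne_zero two_ne_zero hm)

theorem unique (hm0 : 0 < m) (h : BData m f g w a b) (h' : BData m f g w' a' b') :
    w = w' ∧ a = a' ∧ b = b' := by
  have := h.sub h'
  rw [sub_self, sub_self] at this
  obtain ⟨h1, h2, h3⟩ := this.eq_zero hm0
  exact ⟨sub_eq_zero.1 h1, sub_eq_zero.1 h2, sub_eq_zero.1 h3⟩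

end BData

/-! ### Dilations -/

theorem quasiMeasurePreserving_mul {l : ℝ} (hl : 0 < l) :
    Measure.QuasiMeasurePreserving (fun x => l * x) vol vol := by
  have h : Measure.QuasiMeasurePreserving (fun x : ℝ => l * x) volume volume :=
    ⟨measurable_const_mul l, by
      rw [Real.map_volume_mul_left hl.ne']
      exact Measure.smul_absolutelyContinuous⟩
  exact h.restrict fun x hx => mul_pos hl hx

theorem memLp_comp_mul {l : ℝ} (hl : 0 < l) (f : L2) : MemLp (fun x => f (l * x)) 2 vol := by
  have hmeas : AEStronglyMeasurable (fun x => f (l * x)) vol :=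
    (Lp.aestronglyMeasurable f).comp_quasiMeasurePreserving (quasiMeasurePreserving_mul hl)
  rw [memLp_two_iff_integrable_sq_norm hmeas]
  have h := (memLp_two_iff_integrable_sq_norm (Lp.aestronglyMeasurable f)).1 (Lp.memLp f)
  have := (integrableOn_Ioi_comp_mul_left_iff (fun x => ‖f x‖ ^ 2) 0 hl).2
    (by rw [mul_zero]; exact h)
  exact this

/-- The dilation `f ↦ f(l ·)`. -/
def dil {l : ℝ} (hl : 0 < l) (f : L2) : L2 := (memLp_comp_mul hl f).toLp _

theorem coeFn_dil {l : ℝ} (hl : 0 < l) (f : L2) : dil hl f =ᵐ[vol] fun x => f (l * x) :=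
  (memLp_comp_mul hl f).coeFn_toLp

theorem norm_sq_eq_integral (f : L2) : ‖f‖ ^ 2 = ∫ x in Ioi 0, ‖f x‖ ^ 2 := by
  have h := L2.inner_def (𝕜 := ℂ) f f
  rw [inner_self_eq_norm_sq_to_K] at h
  have h2 : ∀ x, ⟪f x, f x⟫_ℂ = ((‖f x‖ ^ 2 : ℝ) : ℂ) := fun x => by
    rw [inner_self_eq_norm_sq_to_K]
    push_cast
    rfl
  simp only [h2] at h
  rw [integral_complex_ofReal] at h
  have h3 : ((‖f‖ : ℂ)) ^ 2 = ((∫ x, ‖f x‖ ^ 2 ∂vol : ℝ) : ℂ) := h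
  rw [← Complex.ofReal_pow] at h3
  exact Complex.ofReal_injective h3

theorem norm_dil_sq {l : ℝ} (hl : 0 < l) (f : L2) : ‖dil hl f‖ ^ 2 = l⁻¹ * ‖f‖ ^ 2 := by
  rw [norm_sq_eq_integral, norm_sq_eq_integral, setIntegral_congr_ae measurableSet_Ioi
    (g := fun x => ‖f (l * x)‖ ^ 2), integral_comp_mul_left_Ioi (fun x => ‖f x‖ ^ 2) 0 hl]
  · simp
  · filter_upwards [(ae_restrict_iff' measurableSet_Ioi).1 (coeFn_dil hl f)] with x hx h0
    rw [hx h0]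

theorem ae_comp_mul {l : ℝ} (hl : 0 < l) {P : ℝ → Prop} (h : ∀ᵐ x ∂vol, P x) :
    ∀ᵐ x ∂vol, P (l * x) :=
  (quasiMeasurePreserving_mul hl).ae h

theorem pw_mul (m : ℝ) {l x : ℝ} (hl : 0 < l) (hx : 0 < x) : pw m (l * x) = pw m l * pw m x := by
  rw [pw, Real.mul_rpow hl.le hx.le, Complex.ofReal_mul]
  rfl

theorem dil_smul {l : ℝ} (hl : 0 < l) (c : ℂ) (f : L2) : dil hl (c • f) = c • dil hl f := by
  refine Lp.ext ?_
  filter_upwards [coeFn_dil hl (c • f), coeFn_dil hl f, Lp.coeFn_smul c (dil hl f),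
    ae_comp_mul hl (Lp.coeFn_smul c f)] with x h1 h2 h3 h4
  rw [h1, h3, Pi.smul_apply, h2, h4, Pi.smul_apply]

theorem tendsto_mul_nhdsGT {l : ℝ} (hl : 0 < l) :
    Tendsto (fun x => l * x) (𝓝[>] 0) (𝓝[>] 0) := by
  refine tendsto_nhdsWithin_iff.2 ⟨?_, ?_⟩
  · have : Tendsto (fun x => l * x) (𝓝 0) (𝓝 (l * 0)) := (continuous_const_mul l).tendsto 0
    rw [mul_zero] at this
    exact this.mono_left nhdsWithin_le_nhds
  · filter_upwards [self_mem_nhdsWithin] with x hx using mul_pos hl hx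

theorem IsPrimitive.comp_mul {u u' : ℝ → ℂ} {l : ℝ} (hl : 0 < l) (h : IsPrimitive u u') :
    IsPrimitive (fun x => u (l * x)) fun x => l * u' (l * x) := by
  intro a b ha hb
  have h1 := h (l * a) (l * b) (mul_pos hl ha) (mul_pos hl hb)
  have h2 := h1.1.comp_mul_left (c := l)
  rw [mul_div_cancel_left₀ _ hl.ne', mul_div_cancel_left₀ _ hl.ne'] at h2
  refine ⟨h2.const_mul _, ?_⟩
  rw [intervalIntegral.integral_const_mul, intervalIntegral.integral_comp_mul_left u' hl.ne',
    ← h1.2, Complex.real_smul, ← mul_assoc, ← Complex.ofReal_mul, mul_inv_cancel₀ hl.ne',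
    Complex.ofReal_one, one_mul]

/-- The maximal operator is homogeneous of degree `-2`, and the boundary values of `f(l ·)` are
those of `f` multiplied by `l^(1/2 - m)` and `l^(1/2 + m)`. -/
theorem BData.dil {m : ℝ} {f g w : L2} {a b : ℂ} {l : ℝ} (hl : 0 < l) (h : BData m f g w a b) :
    BData m (dil hl f) (((l ^ 2 : ℝ) : ℂ) • dil hl g) ((l : ℂ) • dil hl w) (pw m l * a)
      (pw (-m) l * b) := by
  obtain ⟨u, K, hs, hf, hw, ha, hb⟩ := h
  have hpl := pw_ne_zero m hl
  have hpp : pw (-m) l = l / pw m l := pw_neg_eq hl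
  refine ⟨fun x => pw m l * u (l * x), fun x => pw (-m) l * K (l * x), ⟨?_, ?_⟩, ?_, ?_, ?_, ?_⟩
  · refine ((hs.du.comp_mul hl).const_mul (pw m l)).congr (fun _ _ => rfl) fun x hx => ?_
    have := pw_ne_zero m hx
    rw [hpp, pw_mul m hl hx]
    field_simp
  · refine (((hs.dK.comp_mul hl).const_mul (pw (-m) l)).congr_ae ?_)
    filter_upwards [coeFn_dil hl g, Lp.coeFn_smul ((l ^ 2 : ℝ) : ℂ) (HomSchrodinger.dil hl g),
      self_mem_ae_restrict measurableSet_Ioi] with x h1 h2 hx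
    rw [h2, Pi.smul_apply, h1, hpp, pw_mul m hl hx, smul_eq_mul]
    push_cast
    field_simp
  · filter_upwards [coeFn_dil hl f, ae_comp_mul hl hf, self_mem_ae_restrict measurableSet_Ioi]
      with x h1 h2 hx
    rw [h1, h2, pw_mul m hl hx]
    ring
  · filter_upwards [coeFn_dil hl w, ae_comp_mul hl hw, self_mem_ae_restrict measurableSet_Ioi,
      Lp.coeFn_smul (l : ℂ) (HomSchrodinger.dil hl w)] with x h1 h2 hx h3
    have := pw_ne_zero m hx
    rw [h3, Pi.smul_apply, h1, h2, pw_mul m hl hx, hpp, smul_eq_mul]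
    field_simp
  · exact (ha.comp (tendsto_mul_nhdsGT hl)).const_mul _
  · rw [mul_left_comm]
    exact (hb.comp (tendsto_mul_nhdsGT hl)).const_mul _

/-! ### Elements of the maximal domain with given boundary data -/

theorem Sol.exists_bData {m : ℝ} (hm0 : 0 < m) (hm1 : m < 1) {u K : ℝ → ℂ} {f g : L2} {a b : ℂ}
    (hs : Sol m u K g) (hf : f =ᵐ[vol] fun x => pw m x * u x) (ha : Tendsto u (𝓝[>] 0) (𝓝 a))
    (hb : Tendsto K (𝓝[>] 0) (𝓝 (2 * m * b))) : ∃ w, BData m f g w a b :=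
  ⟨(hs.memLp_div hm0 hm1 hf).toLp _, u, K, hs, hf, (hs.memLp_div hm0 hm1 hf).coeFn_toLp, ha, hb⟩

/-- A test function as an element of `L²`. -/
def testL2 (φ : Test) : L2 := (memLp_test φ).toLp _

/-- The image of a test function under the differential expression, as an element of `L²`. -/
def testImage (m : ℝ) (φ : Test) : L2 := (memLp_diffExpr m φ).toLp _

theorem exists_bData_test {m : ℝ} (hm0 : 0 < m) (hm1 : m < 1) (φ : Test) :
    ∃ w, BData m (testL2 φ) (testImage m φ) w 0 0 := by
  obtain ⟨δ, R, hδ, -, hsub⟩ := exists_Ioo_of_isCompact φ.hasCompactSupport (tsupport_subset_Ioi φ)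
  have h0 : ∀ᶠ x in 𝓝[>] (0 : ℝ), φ x = 0 ∧ deriv φ x = 0 := by
    filter_upwards [Ioo_mem_nhdsGT hδ] with x hx
    have hx' : x ∉ tsupport φ := fun h => absurd (hsub h).1 (not_lt.2 hx.2.le)
    exact ⟨image_eq_zero_of_notMem_tsupport hx',
      image_eq_zero_of_notMem_tsupport fun h => hx' (tsupport_deriv_subset h)⟩
  refine ((sol_test m φ).congr_ae (memLp_diffExpr m φ).coeFn_toLp.symm).exists_bData hm0 hm1 ?_
    (tendsto_const_nhds.congr' ?_) (tendsto_const_nhds.congr' ?_)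
  · filter_upwards [(memLp_test φ).coeFn_toLp, self_mem_ae_restrict measurableSet_Ioi] with x h1 hx
    have := pw_ne_zero m hx
    rw [testL2, h1]
    field_simp
  · filter_upwards [h0] with x hx
    rw [hx.1, zero_div]
  · filter_upwards [h0] with x hx
    rw [hx.1, hx.2, mul_zero, mul_zero, mul_zero, sub_zero]

theorem memLp_cutoff_mul {n : ℝ} (hn : n < 1) {ξ : ℝ → ℂ} (hξ : IsCutoff ξ) :
    MemLp (fun x => ξ x * pw n x) 2 vol := by
  have hc : ContinuousOn (fun x => ξ x * pw n x) (Ioi 0) :=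
    hξ.1.continuous.continuousOn.mul (continuousOn_pw n)
  have h : MemLp (fun x => ξ x * pw n x) 2 (volume.restrict (Ioc 0 2)) := by
    obtain ⟨C, hC⟩ := (isCompact_Icc (a := (0 : ℝ)) (b := 2)).exists_bound_of_continuousOn
      hξ.1.continuous.continuousOn
    refine (memLp_pw_Ioc hn 2).of_le_mul (c := C)
      ((hc.mono fun x hx => hx.1).aestronglyMeasurable measurableSet_Ioc) ?_
    refine (ae_restrict_iff' measurableSet_Ioc).2 (Eventually.of_forall fun x hx => ?_)
    rw [norm_mul]
    exact mul_le_mul_of_nonneg_right (hC x ⟨hx.1.le, hx.2⟩) (norm_nonneg _)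
  rw [← memLp_indicator_iff_restrict measurableSet_Ioc] at h
  refine (memLp_congr_ae ?_).1 (h.restrict (Ioi 0))
  filter_upwards [self_mem_ae_restrict measurableSet_Ioi] with x hx
  by_cases h2 : x ≤ 2
  · rw [indicator_of_mem (show x ∈ Ioc 0 2 from ⟨hx, h2⟩)]
  · rw [indicator_of_notMem (fun h => h2 h.2), hξ.2.2 x (not_le.1 h2).le, zero_mul]

theorem IsCutoff.deriv_eq_zero {ξ : ℝ → ℂ} (hξ : IsCutoff ξ) {x : ℝ} (hx : x < 1 ∨ 2 < x) :
    deriv ξ x = 0 := by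
  rcases hx with hx | hx
  · have : ξ =ᶠ[𝓝 x] fun _ => 1 := by
      filter_upwards [Iio_mem_nhds hx] with y hy using hξ.2.1 y (le_of_lt hy)
    rw [this.deriv_eq, deriv_const]
  · have : ξ =ᶠ[𝓝 x] fun _ => 0 := by
      filter_upwards [Ioi_mem_nhds hx] with y hy using hξ.2.2 y (le_of_lt hy)
    rw [this.deriv_eq, deriv_const]

theorem IsCutoff.deriv_deriv_eq_zero {ξ : ℝ → ℂ} (hξ : IsCutoff ξ) {x : ℝ} (hx : x < 1 ∨ 2 < x) :
    deriv (deriv ξ) x = 0 := by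
  have : deriv ξ =ᶠ[𝓝 x] fun _ => 0 := by
    rcases hx with hx | hx
    · filter_upwards [Iio_mem_nhds hx] with y hy using hξ.deriv_eq_zero (Or.inl hy)
    · filter_upwards [Ioi_mem_nhds hx] with y hy using hξ.deriv_eq_zero (Or.inr hy)
  rw [this.deriv_eq, deriv_const]

/-- For `n = ± m`, the function `x^(1/2 - n)` solves the homogeneous equation, so that the image of
its product with a cut-off function is supported in `[1, 2]`. -/
theorem exists_cutoff_sol {m n : ℝ} (hn : n ^ 2 = m ^ 2) {ξ : ℝ → ℂ} (hξ : IsCutoff ξ) :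
    ∃ g : L2, Sol m (fun x => ξ x * pw n x / pw m x)
      (fun x => pw m x * (deriv ξ x * pw n x + ξ x * ((1 / 2 - n) * pw n x / x)) -
        (1 / 2 - m) * pw m x / x * (ξ x * pw n x)) g := by
  have h1 := contDiff_infty_iff_deriv.1 hξ.1
  have h2 := contDiff_infty_iff_deriv.1 h1.2
  have cq := continuousOn_pw n
  have cx : ContinuousOn (fun x : ℝ => (x : ℂ)) (Ioi 0) := Complex.continuous_ofReal.continuousOn
  have hx0 : ∀ x ∈ Ioi (0 : ℝ), (x : ℂ) ≠ 0 := fun x hx => Complex.ofReal_ne_zero.2 (ne_of_gt hx)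
  set G : ℝ → ℂ := fun x => -(deriv (deriv ξ) x * pw n x +
    2 * (deriv ξ x * ((1 / 2 - n) * pw n x / x))) with hG
  have cG : ContinuousOn G (Ioi 0) :=
    ((h2.2.continuous.continuousOn.mul cq).add (continuousOn_const.mul
      (h1.2.continuous.continuousOn.mul ((continuousOn_const.mul cq).div cx hx0)))).neg
  have hGL : MemLp G 2 vol := by
    have h : MemLp G 2 (volume.restrict (Icc (1 : ℝ) 2)) := by
      have c1 : ContinuousOn G (Icc 1 2) := cG.mono fun x hx => one_pos.trans_le hx.1
      rw [memLp_two_iff_integrable_sq_norm (c1.aestronglyMeasurable measurableSet_Icc)]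
      exact (c1.norm.pow 2).integrableOn_Icc
    rw [← memLp_indicator_iff_restrict measurableSet_Icc] at h
    have h0 : (Icc (1 : ℝ) 2).indicator G = G := by
      refine indicator_eq_self.2 fun x hx => ?_
      by_contra hx'
      have hx2 : x < 1 ∨ 2 < x := by
        rcases not_and_or.1 hx' with h | h
        · exact Or.inl (not_le.1 h)
        · exact Or.inr (not_le.1 h)
      refine hx ?_
      rw [hG]
      simp only
      rw [hξ.deriv_eq_zero hx2, hξ.deriv_deriv_eq_zero hx2]
      ring
    rw [h0] at h
    exact h.restrict _
  refine ⟨hGL.toLp G, Sol.congr_ae (g := G) ?_ hGL.coeFn_toLp.symm⟩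
  have dq : ∀ x, 0 < x → HasDerivAt (fun x : ℝ => (1 / 2 - n) * pw n x / x)
      (((n : ℂ) ^ 2 - 1 / 4) / x ^ 2 * pw n x) x := by
    intro x hx
    have hxx := (hasDerivAt_id x).ofReal_comp
    refine ((((hasDerivAt_pw n hx).const_mul (1 / 2 - n : ℂ)).div hxx (hx0 x hx))).congr_deriv ?_
    have := hx0 x hx
    simp only [id]
    field_simp
    push_cast
    ring
  refine Sol.of_hasDerivAt
    (F'' := fun x => deriv (deriv ξ) x * pw n x + deriv ξ x * ((1 / 2 - n) * pw n x / x) +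
      (deriv ξ x * ((1 / 2 - n) * pw n x / x) +
        ξ x * (((n : ℂ) ^ 2 - 1 / 4) / x ^ 2 * pw n x)))
    (fun x hx => (h1.1 x).hasDerivAt.mul (hasDerivAt_pw n hx))
    (fun x hx => ((h2.1 x).hasDerivAt.mul (hasDerivAt_pw n hx)).add
      ((h1.1 x).hasDerivAt.mul (dq x hx))) ?_ fun x hx => ?_
  · have c3 := h1.2.continuous.continuousOn.mul ((continuousOn_const (c := (1 / 2 - n : ℂ))
      |>.mul cq).div cx hx0)
    exact ((h2.2.continuous.continuousOn.mul cq).add c3).add (c3.add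
      (hξ.1.continuous.continuousOn.mul ((continuousOn_const.div (cx.pow 2) fun x hx =>
        pow_ne_zero 2 (hx0 x hx)).mul cq)))
  · have hn' : (n : ℂ) ^ 2 = (m : ℂ) ^ 2 := by exact_mod_cast hn
    rw [hG, ← hn]
    push_cast
    ring

/-- The function `ξ(x) x^(1/2 + n)`, as an element of `L²` for `-1 < n`. -/
def cutoffL2 {ξ : ℝ → ℂ} (hξ : IsCutoff ξ) {n : ℝ} (hn : -n < 1) : L2 :=
  (memLp_cutoff_mul hn hξ).toLp _

theorem coeFn_cutoffL2 {ξ : ℝ → ℂ} (hξ : IsCutoff ξ) {n : ℝ} (hn : -n < 1) :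
    cutoffL2 hξ hn =ᵐ[vol] fun x => ξ x * ((x ^ (1 / 2 + n) : ℝ) : ℂ) := by
  filter_upwards [(memLp_cutoff_mul hn hξ).coeFn_toLp] with x hx
  rw [cutoffL2, hx, pw_neg]

theorem pw_neg_div {m : ℝ} {x : ℝ} (hx : 0 < x) :
    pw (-m) x / pw m x = ((x ^ (2 * m) : ℝ) : ℂ) := by
  rw [div_eq_iff (pw_ne_zero m hx), pw_neg, pw, ← Complex.ofReal_mul, ← Real.rpow_add hx]
  ring_nf

theorem tendsto_pw_neg_div {m : ℝ} (hm0 : 0 < m) :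
    Tendsto (fun x => pw (-m) x / pw m x) (𝓝[>] 0) (𝓝 0) := by
  have h : Tendsto (fun x : ℝ => ((x ^ (2 * m) : ℝ) : ℂ)) (𝓝 0) (𝓝 (((0 : ℝ) ^ (2 * m) : ℝ))) :=
    (Complex.continuous_ofReal.tendsto _).comp
      ((Real.continuousAt_rpow_const 0 (2 * m) (Or.inr (by positivity))).tendsto)
  rw [Real.zero_rpow (by positivity), Complex.ofReal_zero] at h
  refine (h.mono_left nhdsWithin_le_nhds).congr' ?_
  filter_upwards [self_mem_nhdsWithin] with x hx
  rw [pw_neg_div hx]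

theorem exists_bData_cutoff_neg {m : ℝ} (hm0 : 0 < m) (hm1 : m < 1) {ξ : ℝ → ℂ} (hξ : IsCutoff ξ)
    (hn : -(-m) < 1) : ∃ g w, BData m (cutoffL2 hξ hn) g w 1 0 := by
  obtain ⟨g, hg⟩ := exists_cutoff_sol (m := m) (n := m) rfl hξ
  refine ⟨g, hg.exists_bData hm0 hm1 ?_ (tendsto_const_nhds.congr' ?_)
    (tendsto_const_nhds.congr' ?_)⟩
  · filter_upwards [(memLp_cutoff_mul hn hξ).coeFn_toLp, self_mem_ae_restrict measurableSet_Ioi]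
      with x h1 hx
    have := pw_ne_zero m hx
    rw [cutoffL2, h1, neg_neg]
    field_simp
  · filter_upwards [Ioo_mem_nhdsGT one_pos] with x hx
    have := pw_ne_zero m hx.1
    rw [hξ.2.1 x hx.2.le]
    field_simp
  · filter_upwards [Ioo_mem_nhdsGT one_pos] with x hx
    rw [hξ.2.1 x hx.2.le, hξ.deriv_eq_zero (Or.inl hx.2)]
    ring

theorem exists_bData_cutoff {m : ℝ} (hm0 : 0 < m) (hm1 : m < 1) {ξ : ℝ → ℂ} (hξ : IsCutoff ξ)
    (hn : -m < 1) : ∃ g w, BData m (cutoffL2 hξ hn) g w 0 1 := by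
  obtain ⟨g, hg⟩ := exists_cutoff_sol (m := m) (n := -m) (neg_sq m) hξ
  refine ⟨g, hg.exists_bData hm0 hm1 ?_ ((tendsto_pw_neg_div hm0).congr' ?_)
    (tendsto_const_nhds.congr' ?_)⟩
  · filter_upwards [(memLp_cutoff_mul hn hξ).coeFn_toLp, self_mem_ae_restrict measurableSet_Ioi]
      with x h1 hx
    have := pw_ne_zero m hx
    rw [cutoffL2, h1]
    field_simp
  · filter_upwards [Ioo_mem_nhdsGT one_pos] with x hx
    rw [hξ.2.1 x hx.2.le, one_mul]
  · filter_upwards [Ioo_mem_nhdsGT one_pos] with x hx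
    have := pw_ne_zero m hx.1
    have hx0 : (x : ℂ) ≠ 0 := Complex.ofReal_ne_zero.2 hx.1.ne'
    rw [hξ.2.1 x hx.2.le, hξ.deriv_eq_zero (Or.inl hx.2), pw_neg_eq hx.1]
    push_cast
    field_simp
    ring

/-! ### The boundary condition -/

theorem hasDerivAt_uTheta (m θ : ℝ) {x : ℝ} (hx : 0 < x) :
    HasDerivAt (uTheta m θ) ((1 / 2 - m) * pw m x / x * Real.cos θ +
      (1 / 2 + m) * pw (-m) x / x * Real.sin θ) x := by
  have h := ((hasDerivAt_pw m hx).mul_const (Real.cos θ : ℂ)).add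
    ((hasDerivAt_pw (-m) hx).mul_const (Real.sin θ : ℂ))
  refine (h.congr_of_eventuallyEq (Eventually.of_forall fun y => ?_)).congr_deriv (by
    push_cast
    ring)
  rw [uTheta, Pi.add_apply, pw_neg, pw]
  push_cast
  ring

/-- The Wronskian of `u_θ` and of an element of the maximal domain with boundary values `a`, `b`
tends to `2 m (b cos θ - a sin θ)`. -/
theorem BData.mem_wronskianKer_iff {m : ℝ} (hm0 : 0 < m) {f g w : L2} {a b : ℂ}
    (h : BData m f g w a b) (θ : ℝ) :
    f ∈ wronskianKer (uTheta m θ) ↔ Real.cos θ * b = Real.sin θ * a := by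
  obtain ⟨u, K, hs, hf, hw, ha, hb⟩ := h
  have hm : (m : ℂ) ≠ 0 := Complex.ofReal_ne_zero.2 hm0.ne'
  have hd : ∀ x, 0 < x → HasDerivAt (fun y => pw m y * u y)
      ((1 / 2 - m) * pw m x / x * u x + K x / pw m x) x := fun x hx => hs.hasDerivAt_pw_mul hx
  have hlim : Tendsto (fun x => uTheta m θ x * ((1 / 2 - m) * pw m x / x * u x + K x / pw m x) -
      deriv (uTheta m θ) x * (pw m x * u x)) (𝓝[>] 0)
      (𝓝 (2 * m * (Real.cos θ * b - Real.sin θ * a))) := by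
    have h1 := (hb.const_mul (Real.cos θ : ℂ)).add ((((tendsto_pw_neg_div hm0).mul hb).sub
      (ha.const_mul (2 * m : ℂ))).const_mul (Real.sin θ : ℂ))
    have e : (Real.cos θ : ℂ) * (2 * m * b) + Real.sin θ * (0 * (2 * m * b) - 2 * m * a) =
        2 * m * (Real.cos θ * b - Real.sin θ * a) := by ring
    rw [e] at h1
    refine h1.congr' ?_
    filter_upwards [self_mem_nhdsWithin] with x hx
    have hx : 0 < x := hx
    have hp := pw_ne_zero m hx
    have hx0 : (x : ℂ) ≠ 0 := Complex.ofReal_ne_zero.2 hx.ne'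
    have hu : uTheta m θ x = pw m x * Real.cos θ + pw (-m) x * Real.sin θ := by
      rw [uTheta, pw_neg, pw]
      push_cast
      ring
    rw [(hasDerivAt_uTheta m θ hx).deriv, hu, pw_neg_eq hx]
    field_simp
    ring
  have hcd : ContDiffOn ℝ 1 (fun y => pw m y * u y) (Ioi 0) := by
    rw [show (1 : WithTop ℕ∞) = 0 + 1 from (zero_add 1).symm,
      contDiffOn_succ_iff_deriv_of_isOpen isOpen_Ioi]
    refine ⟨fun x hx => (hd x hx).differentiableAt.differentiableWithinAt, by simp, ?_⟩
    rw [contDiffOn_zero]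
    refine ContinuousOn.congr ?_ fun x hx => (hd x hx).deriv
    exact (((continuousOn_const.mul (continuousOn_pw m)).div
      Complex.continuous_ofReal.continuousOn fun x hx =>
        Complex.ofReal_ne_zero.2 (ne_of_gt hx)).mul hs.du.continuousOn).add hs.continuousOn_div
  constructor
  · rintro ⟨F, hF, dF, wF⟩
    have hEq : EqOn F (fun y => pw m y * u y) (Ioi 0) :=
      Measure.eqOn_open_of_ae_eq (hF.symm.trans hf) isOpen_Ioi dF.continuousOn hcd.continuousOn
    have := tendsto_nhds_unique hlim (wF.congr' (by
      filter_upwards [self_mem_nhdsWithin] with x hx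
      have h1 : F =ᶠ[𝓝 x] fun y => pw m y * u y := by
        filter_upwards [Ioi_mem_nhds hx] with y hy using hEq hy
      rw [h1.deriv_eq, (hd x hx).deriv, hEq hx]))
    exact sub_eq_zero.1 ((mul_eq_zero.1 this).resolve_left (mul_ne_zero two_ne_zero hm))
  · intro h
    refine ⟨_, hf, hcd, ?_⟩
    rw [h, sub_self, mul_zero] at hlim
    refine hlim.congr' ?_
    filter_upwards [self_mem_nhdsWithin] with x hx
    rw [(hd x hx).deriv]

/-! ### Unbounded operators and their graphs -/

section Abstract

variable {E : Type*} [NormedAddCommGroup E] [InnerProductSpace ℂ E]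

theorem mem_graph_domRestrict {T : E →ₗ.[ℂ] E} {p : Submodule ℂ E} {f g : E} :
    (f, g) ∈ (T.domRestrict p).graph ↔ f ∈ p ∧ (f, g) ∈ T.graph := by
  constructor
  · intro h
    have hf : f ∈ (T.domRestrict p).domain := LinearPMap.mem_domain_of_mem_graph h
    exact ⟨hf.1, LinearPMap.le_graph_of_le LinearPMap.domRestrict_le h⟩
  · rintro ⟨hp, h⟩
    rw [LinearPMap.mem_graph_iff] at h ⊢
    obtain ⟨y, hy, hT⟩ := h
    exact ⟨⟨f, hp, (show (y : E) = f from hy) ▸ y.2⟩, rfl, (LinearPMap.domRestrict_apply hy.symm).trans hT⟩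

theorem mem_graph_of_mem {T : E →ₗ.[ℂ] E} {f : E} (h : f ∈ T.domain) :
    (f, T ⟨f, h⟩) ∈ T.graph := T.mem_graph ⟨f, h⟩

theorem apply_eq_of_mem_graph {T : E →ₗ.[ℂ] E} {f g : E} (h : (f, g) ∈ T.graph) :
    T ⟨f, LinearPMap.mem_domain_of_mem_graph h⟩ = g :=
  T.mem_graph_snd_inj (mem_graph_of_mem _) h rfl

theorem mem_eigenspace_iff {T : E →ₗ.[ℂ] E} {z : ℂ} {x : E} :
    x ∈ eigenspace T z ↔ (x, z • x) ∈ T.graph := by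
  constructor
  · rintro ⟨h, hx⟩
    rw [← hx]
    exact mem_graph_of_mem h
  · intro h
    exact ⟨LinearPMap.mem_domain_of_mem_graph h, apply_eq_of_mem_graph h⟩

variable [CompleteSpace E]

/-- In a Hilbert space the double adjoint of a graph is contained in its closure. -/
theorem adjoint_adjoint_le_topologicalClosure (G : Submodule ℂ (E × E)) :
    G.adjoint.adjoint ≤ G.topologicalClosure := by
  rintro ⟨f, g⟩ h
  rw [Submodule.mem_adjoint_iff] at h
  let e := WithLp.prodContinuousLinearEquiv 2 ℂ E E
  let M : Submodule ℂ (WithLp 2 (E × E)) := G.comap (e : WithLp 2 (E × E) →ₗ[ℂ] E × E)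
  have hM : e.symm (f, g) ∈ M.topologicalClosure := by
    rw [← Submodule.orthogonal_orthogonal_eq_closure, Submodule.mem_orthogonal]
    intro y hy
    rw [Submodule.mem_orthogonal] at hy
    have h1 : (y.snd, -y.fst) ∈ G.adjoint := by
      rw [Submodule.mem_adjoint_iff]
      intro a b hab
      have := hy (e.symm (a, b)) hab
      rw [WithLp.prod_inner_apply] at this
      rw [inner_neg_right, sub_neg_eq_add, add_comm]
      exact this
    have h2 := h _ _ h1
    rw [WithLp.prod_inner_apply]
    rw [inner_neg_left] at h2
    change ⟪y.fst, f⟫_ℂ + ⟪y.snd, g⟫_ℂ = 0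
    linear_combination -h2
  have := map_mem_closure e.continuous hM (t := G) fun y hy => hy
  exact this

theorem isSelfAdjoint_of_graph {T : E →ₗ.[ℂ] E} (hd : Dense (T.domain : Set E))
    (h : T.graph.adjoint = T.graph) : IsSelfAdjoint T := by
  rw [LinearPMap.isSelfAdjoint_def]
  exact LinearPMap.eq_of_eq_graph ((LinearPMap.adjoint_graph_eq_graph_adjoint hd).trans h)

theorem adjoint_graph_of_isSelfAdjoint {T : E →ₗ.[ℂ] E} (h : IsSelfAdjoint T) :
    T.graph.adjoint = T.graph := by
  rw [← LinearPMap.adjoint_graph_eq_graph_adjoint h.dense_domain, LinearPMap.isSelfAdjoint_def.1 h]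

theorem inner_symm_of_isSelfAdjoint {T : E →ₗ.[ℂ] E} (h : IsSelfAdjoint T) {a b f g : E}
    (hab : (a, b) ∈ T.graph) (hfg : (f, g) ∈ T.graph) : ⟪b, f⟫_ℂ = ⟪a, g⟫_ℂ := by
  rw [← adjoint_graph_of_isSelfAdjoint h, Submodule.mem_adjoint_iff] at hfg
  exact sub_eq_zero.1 (hfg a b hab)

/-- If `T` is self-adjoint, `T - z` is bounded below and `T - z̄` is injective, then `T - z` is onto:
its range is closed and its orthogonal complement is the kernel of `T - z̄`. -/
theorem exists_graph_eq {T : E →ₗ.[ℂ] E} (h : IsSelfAdjoint T) (z : ℂ) {c : ℝ} (hc : 0 < c)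
    (hb : ∀ f g, (f, g) ∈ T.graph → c * ‖f‖ ≤ ‖g - z • f‖)
    (hk : ∀ f, (f, conj z • f) ∈ T.graph → f = 0) (y : E) : ∃ f, (f, y + z • f) ∈ T.graph := by
  have hcl : IsClosed (T.graph : Set (E × E)) := h.isClosed
  let R : Submodule ℂ E := T.graph.map (LinearMap.snd ℂ E E - z • LinearMap.fst ℂ E E)
  have hR : ∀ v, v ∈ R ↔ ∃ f, (f, v + z • f) ∈ T.graph := by
    intro v
    constructor
    · rintro ⟨⟨f, g⟩, hfg, rfl⟩
      refine ⟨f, ?_⟩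
      simpa using hfg
    · rintro ⟨f, hf⟩
      exact ⟨_, hf, by simp⟩
  have hRc : IsClosed (R : Set E) := by
    refine IsSeqClosed.isClosed fun v y hv hy => ?_
    choose f hf using fun n => (hR (v n)).1 (hv n)
    have hdist : ∀ n k, c * ‖f n - f k‖ ≤ ‖v n - v k‖ := fun n k => by
      have := hb _ _ (T.graph.sub_mem (hf n) (hf k))
      rwa [show v n + z • f n - (v k + z • f k) - z • (f n - f k) = v n - v k by
        rw [smul_sub]; abel] at this
    have hcs : CauchySeq f := by
      have hvc := hy.cauchySeq
      rw [Metric.cauchySeq_iff] at hvc ⊢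
      intro ε hε
      obtain ⟨N, hN⟩ := hvc (c * ε) (by positivity)
      refine ⟨N, fun n hn k hk => ?_⟩
      have h1 := hN n hn k hk
      rw [dist_eq_norm] at h1 ⊢
      exact lt_of_mul_lt_mul_left ((hdist n k).trans_lt h1) hc.le
    obtain ⟨f₀, hf₀⟩ := cauchySeq_tendsto_of_complete hcs
    refine (hR y).2 ⟨f₀, hcl.mem_of_tendsto (hf₀.prodMk_nhds (hy.add (hf₀.const_smul z)))
      (Eventually.of_forall hf)⟩
  have hRt : R = ⊤ := by
    have : CompleteSpace R := hRc.completeSpace_coe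
    rw [← Submodule.orthogonal_eq_bot_iff, Submodule.eq_bot_iff]
    intro x hx
    rw [Submodule.mem_orthogonal] at hx
    refine hk x ?_
    rw [← adjoint_graph_of_isSelfAdjoint h, Submodule.mem_adjoint_iff]
    intro a b hab
    have := hx (b - z • a) ⟨_, hab, by simp⟩
    rw [inner_sub_left, inner_smul_left] at this
    rw [inner_smul_right]
    exact this
  exact (hR y).1 (hRt ▸ Submodule.mem_top)

end Abstract

/-! ### The minimal operator and its extensions in terms of boundary data -/

theorem mem_graph_Lmax {m : ℝ} (hm0 : 0 < m) (hm1 : m < 1) {f g : L2} :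
    (f, g) ∈ (Lmax m).graph ↔ ∃ w a b, BData m f g w a b := by
  rw [graph_Lmax]
  exact ⟨exists_bData hm0 hm1, fun ⟨_, _, _, h⟩ => h.mem_maxGraph⟩

theorem BData.inner_comm {m : ℝ} {f g w f' g' w' : L2} {a b a' b' : ℂ} (h : BData m f g w a b)
    (h' : BData m f' g' w' a' b') :
    ⟪g, f'⟫_ℂ - ⟪f, g'⟫_ℂ = 2 * m * (conj b * a' - conj a * b') := by
  have h2 := congrArg conj (h'.inner_eq h)
  rw [map_add, inner_conj_symm, inner_conj_symm] at h2
  rw [h.inner_eq h', h2]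
  simp only [map_mul, Complex.conj_ofReal, Complex.conj_conj, map_ofNat]
  ring

theorem exists_cutoff : ∃ ξ : ℝ → ℂ, IsCutoff ξ := by
  refine ⟨fun x => (Real.smoothTransition (2 - x) : ℂ), ?_, fun x hx => ?_, fun x hx => ?_⟩
  · exact Complex.ofRealCLM.contDiff.comp
      (Real.smoothTransition.contDiff.comp (contDiff_const.sub contDiff_id))
  · beta_reduce
    rw [Real.smoothTransition.one_of_one_le (by linarith), Complex.ofReal_one]
  · beta_reduce
    rw [Real.smoothTransition.zero_of_nonpos (by linarith), Complex.ofReal_zero]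

theorem exists_bData_one_zero {m : ℝ} (hm0 : 0 < m) (hm1 : m < 1) :
    ∃ f g w, BData m f g w 1 0 := by
  obtain ⟨ξ, hξ⟩ := exists_cutoff
  exact ⟨_, exists_bData_cutoff_neg hm0 hm1 hξ (by linarith)⟩

theorem exists_bData_zero_one {m : ℝ} (hm0 : 0 < m) (hm1 : m < 1) :
    ∃ f g w, BData m f g w 0 1 := by
  obtain ⟨ξ, hξ⟩ := exists_cutoff
  exact ⟨_, exists_bData_cutoff hm0 hm1 hξ (by linarith)⟩

/-- The restriction of the maximal operator to the test functions. -/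
abbrev Lcore (m : ℝ) : L2 →ₗ.[ℂ] L2 := (Lmax m).domRestrict testSubspace

theorem testL2_mem_graph {m : ℝ} (hm0 : 0 < m) (hm1 : m < 1) (φ : Test) :
    (testL2 φ, testImage m φ) ∈ (Lcore m).graph := by
  obtain ⟨w, hw⟩ := exists_bData_test hm0 hm1 φ
  exact mem_graph_domRestrict.2 ⟨⟨φ, (memLp_test φ).coeFn_toLp⟩,
    (mem_graph_Lmax hm0 hm1).2 ⟨_, _, _, hw⟩⟩

theorem exists_of_mem_graph_Lcore {m : ℝ} (hm0 : 0 < m) (hm1 : m < 1) {f g : L2}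
    (h : (f, g) ∈ (Lcore m).graph) : ∃ w, BData m f g w 0 0 := by
  obtain ⟨φ, hφ⟩ := (mem_graph_domRestrict.1 h).1
  have hf : f = testL2 φ := Lp.ext (hφ.trans (memLp_test φ).coeFn_toLp.symm)
  obtain ⟨w, hw⟩ := exists_bData_test hm0 hm1 φ
  have hg : g = testImage m φ :=
    (Lcore m).mem_graph_snd_inj h (testL2_mem_graph hm0 hm1 φ) hf
  exact ⟨w, by rwa [hf, hg]⟩

/-- The complex conjugate of a test function. -/
def conjTest (φ : Test) : Test where
  toFun x := star (φ x)
  contDiff' := (starL' ℝ : ℂ ≃L[ℝ] ℂ).contDiff.comp φ.contDiff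
  hasCompactSupport' := φ.hasCompactSupport.comp_left (star_zero ℂ)
  tsupport_subset' := (closure_mono (Function.support_comp_subset (star_zero ℂ) φ)).trans
    φ.tsupport_subset

theorem diffExpr_conjTest (m : ℝ) (φ : Test) (x : ℝ) :
    diffExpr m (conjTest φ) x = conj (diffExpr m φ x) := by
  have h : deriv (deriv fun y => star (φ y)) x = star (deriv (deriv φ) x) := by
    rw [deriv.star', deriv.star]
  change -deriv (deriv fun y => star (φ y)) x + _ * star (φ x) = _
  rw [h, diffExpr, map_add, map_neg, map_mul, Complex.conj_ofReal]
  rfl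

theorem adjoint_graph_Lcore {m : ℝ} (hm0 : 0 < m) (hm1 : m < 1) :
    (Lcore m).graph.adjoint = maxGraph m := by
  ext ⟨f, g⟩
  rw [Submodule.mem_adjoint_iff]
  constructor
  · intro h φ
    have h1 := sub_eq_zero.1 (h _ _ (testL2_mem_graph hm0 hm1 (conjTest φ)))
    rw [L2.inner_def, L2.inner_def] at h1
    have e1 : ∫ x, f x * diffExpr m φ x ∂vol = ∫ x, ⟪testImage m (conjTest φ) x, f x⟫_ℂ ∂vol := by
      refine integral_congr_ae ?_
      filter_upwards [(memLp_diffExpr m (conjTest φ)).coeFn_toLp] with x hx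
      rw [testImage, hx, RCLike.inner_apply', diffExpr_conjTest, Complex.conj_conj, mul_comm]
    have e2 : ∫ x, g x * φ x ∂vol = ∫ x, ⟪testL2 (conjTest φ) x, g x⟫_ℂ ∂vol := by
      refine integral_congr_ae ?_
      filter_upwards [(memLp_test (conjTest φ)).coeFn_toLp] with x hx
      rw [testL2, hx, RCLike.inner_apply', mul_comm]
      change _ = conj (conj (φ x)) * g x
      rw [Complex.conj_conj, mul_comm]
    rw [e1, e2]
    exact h1
  · intro h a b hab
    obtain ⟨w, a', b', hw⟩ := exists_bData hm0 hm1 h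
    obtain ⟨v, hv⟩ := exists_of_mem_graph_Lcore hm0 hm1 hab
    rw [hv.inner_comm hw]
    simp

theorem dense_testSubspace : Dense (testSubspace : Set L2) := by
  rw [Submodule.dense_iff_topologicalClosure_eq_top, Submodule.topologicalClosure_eq_top_iff,
    Submodule.eq_bot_iff]
  intro f hf
  rw [Submodule.mem_orthogonal'] at hf
  have h := (locInt_L2 (star f)).ae_eq_zero fun φ => by
    have h1 := hf (testL2 φ) ⟨φ, (memLp_test φ).coeFn_toLp⟩
    rw [L2.inner_def] at h1
    rw [← h1]
    refine integral_congr_ae ?_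
    filter_upwards [(memLp_test φ).coeFn_toLp, Lp.coeFn_star f] with x hx hs
    rw [testL2, hx, hs, RCLike.inner_apply']
    rfl
  refine Lp.ext ?_
  filter_upwards [h, Lp.coeFn_star f, Lp.coeFn_zero ℂ 2 vol] with x h1 h2 h3
  rw [h2, Pi.star_apply, Pi.zero_apply, star_eq_zero] at h1
  rw [h1, h3, Pi.zero_apply]

theorem graph_Lmin (m : ℝ) : (Lmin m).graph = (Lcore m).graph.topologicalClosure :=
  (isClosable_core m).graph_closure_eq_closure_graph.symm

/-- The minimal domain consists of the elements of the maximal domain without boundary values. -/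
theorem mem_graph_Lmin {m : ℝ} (hm0 : 0 < m) (hm1 : m < 1) {f g : L2} :
    (f, g) ∈ (Lmin m).graph ↔ ∃ w, BData m f g w 0 0 := by
  rw [graph_Lmin]
  constructor
  · intro h
    have hmax : (f, g) ∈ maxGraph m := by
      refine closure_minimal (s := ((Lcore m).graph : Set (L2 × L2))) ?_ (isClosed_maxGraph m) h
      rintro ⟨a, b⟩ hab
      obtain ⟨w, hw⟩ := exists_of_mem_graph_Lcore hm0 hm1 hab
      exact hw.mem_maxGraph
    have horth : ∀ a b, (a, b) ∈ maxGraph m → ⟪b, f⟫_ℂ - ⟪a, g⟫_ℂ = 0 := by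
      intro a b hab
      have hcl : IsClosed {p : L2 × L2 | ⟪b, p.1⟫_ℂ - ⟪a, p.2⟫_ℂ = 0} :=
        isClosed_eq (by fun_prop) continuous_const
      refine closure_minimal (s := ((Lcore m).graph : Set (L2 × L2))) ?_ hcl h
      rintro ⟨c, d⟩ hcd
      rw [← adjoint_graph_Lcore hm0 hm1, Submodule.mem_adjoint_iff] at hab
      have h1 := congrArg conj (hab c d hcd)
      rw [map_sub, inner_conj_symm, inner_conj_symm, map_zero] at h1
      change ⟪b, c⟫_ℂ - ⟪a, d⟫_ℂ = 0
      linear_combination -h1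
    obtain ⟨w, a, b, hw⟩ := exists_bData hm0 hm1 hmax
    have hm : (m : ℂ) ≠ 0 := Complex.ofReal_ne_zero.2 hm0.ne'
    obtain ⟨f₁, g₁, w₁, h₁⟩ := exists_bData_one_zero hm0 hm1
    obtain ⟨f₂, g₂, w₂, h₂⟩ := exists_bData_zero_one hm0 hm1
    have e1 := h₁.inner_comm hw
    rw [horth _ _ h₁.mem_maxGraph] at e1
    have e2 := h₂.inner_comm hw
    rw [horth _ _ h₂.mem_maxGraph] at e2
    have hb : b = 0 := by simpa [hm] using e1
    have ha : a = 0 := by simpa [hm] using e2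
    exact ⟨w, by rwa [ha, hb] at hw⟩
  · rintro ⟨w, hw⟩
    refine adjoint_adjoint_le_topologicalClosure _ ?_
    rw [adjoint_graph_Lcore hm0 hm1, Submodule.mem_adjoint_iff]
    intro a b hab
    obtain ⟨v, a', b', hv⟩ := exists_bData hm0 hm1 hab
    rw [hv.inner_comm hw]
    simp

theorem dense_Lmin {m : ℝ} (hm0 : 0 < m) (hm1 : m < 1) : Dense ((Lmin m).domain : Set L2) := by
  refine dense_testSubspace.mono ?_
  rintro f ⟨φ, hφ⟩
  have hf : f = testL2 φ := Lp.ext (hφ.trans (memLp_test φ).coeFn_toLp.symm)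
  rw [hf]
  exact LinearPMap.mem_domain_of_mem_graph
    (LinearPMap.le_graph_of_le (Lcore m).le_closure (testL2_mem_graph hm0 hm1 φ))

theorem adjoint_graph_Lmin {m : ℝ} (hm0 : 0 < m) (hm1 : m < 1) :
    (Lmin m).graph.adjoint = maxGraph m := by
  refine le_antisymm ?_ ?_
  · rw [← adjoint_graph_Lcore hm0 hm1]
    rintro ⟨f, g⟩ h
    rw [Submodule.mem_adjoint_iff] at h ⊢
    exact fun a b hab => h a b (LinearPMap.le_graph_of_le (Lcore m).le_closure hab)
  · rintro ⟨f, g⟩ h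
    rw [Submodule.mem_adjoint_iff]
    intro a b hab
    obtain ⟨w, a', b', hw⟩ := exists_bData hm0 hm1 h
    obtain ⟨v, hv⟩ := (mem_graph_Lmin hm0 hm1).1 hab
    rw [hv.inner_comm hw]
    simp

theorem adjoint_Lmin {m : ℝ} (hm0 : 0 < m) (hm1 : m < 1) : (Lmin m).adjoint = Lmax m := by
  refine LinearPMap.eq_of_eq_graph ?_
  rw [LinearPMap.adjoint_graph_eq_graph_adjoint (dense_Lmin hm0 hm1), adjoint_graph_Lmin hm0 hm1,
    graph_Lmax]

theorem mem_graph_Htheta {m : ℝ} (hm0 : 0 < m) (hm1 : m < 1) {θ : ℝ} {f g : L2} :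
    (f, g) ∈ (Htheta m θ).graph ↔
      ∃ w a b, BData m f g w a b ∧ Real.cos θ * b = Real.sin θ * a := by
  rw [Htheta, Lext, mem_graph_domRestrict, mem_graph_Lmax hm0 hm1]
  constructor
  · rintro ⟨hf, w, a, b, h⟩
    exact ⟨w, a, b, h, (h.mem_wronskianKer_iff hm0 θ).1 hf⟩
  · rintro ⟨w, a, b, h, hab⟩
    exact ⟨(h.mem_wronskianKer_iff hm0 θ).2 hab, w, a, b, h⟩

theorem mem_homDomain_iff {n : ℝ} {ξ : ℝ → ℂ} (hξ : IsCutoff ξ) (hn : -n < 1) {f : L2} :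
    f ∈ homDomain ξ n ↔ ∃ f₀ ∈ (Lmin n).domain, ∃ c : ℂ, f = f₀ + c • cutoffL2 hξ hn := by
  have key : ∀ (f₀ : L2) (c : ℂ), (f₀ + c • cutoffL2 hξ hn : L2) =ᵐ[vol]
      fun x => f₀ x + c * (ξ x * ((x ^ (1 / 2 + n) : ℝ) : ℂ)) := by
    intro f₀ c
    filter_upwards [Lp.coeFn_add f₀ (c • cutoffL2 hξ hn), Lp.coeFn_smul c (cutoffL2 hξ hn),
      coeFn_cutoffL2 hξ hn] with x h1 h2 h3
    rw [h1, Pi.add_apply, h2, Pi.smul_apply, h3, smul_eq_mul]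
  constructor
  · rintro ⟨f₀, hf₀, c, hf⟩
    exact ⟨f₀, hf₀, c, Lp.ext (hf.trans (key f₀ c).symm)⟩
  · rintro ⟨f₀, hf₀, c, rfl⟩
    exact ⟨f₀, hf₀, c, key f₀ c⟩

theorem maxGraph_neg (m : ℝ) : maxGraph (-m) = maxGraph m := by
  ext p
  have : ∀ φ : Test, diffExpr (-m) φ = diffExpr m φ := fun φ => by
    funext x
    rw [diffExpr, diffExpr, neg_sq]
  change (∀ φ : Test, _) ↔ ∀ φ : Test, _
  simp only [this]

theorem Lmax_neg (m : ℝ) : Lmax (-m) = Lmax m := by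
  rw [Lmax, Lmax, maxGraph_neg]

theorem Lmin_neg (m : ℝ) : Lmin (-m) = Lmin m := by
  rw [Lmin, Lmin, Lmax_neg]

theorem Hop_eq {m : ℝ} (hm0 : 0 < m) (hm1 : m < 1) {ξ : ℝ → ℂ} (hξ : IsCutoff ξ) :
    Hop ξ m = Htheta m (Real.pi / 2) := by
  have hn : -m < 1 := by linarith
  obtain ⟨g₁, w₁, h₁⟩ := exists_bData_cutoff hm0 hm1 hξ hn
  refine LinearPMap.eq_of_eq_graph ?_
  ext ⟨f, g⟩
  rw [mem_graph_Htheta hm0 hm1, Hop, mem_graph_domRestrict, mem_homDomain_iff hξ hn,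
    mem_graph_Lmax hm0 hm1]
  simp only [Real.cos_pi_div_two, Real.sin_pi_div_two, Complex.ofReal_zero, Complex.ofReal_one,
    zero_mul, one_mul]
  constructor
  · rintro ⟨⟨f₀, hf₀, c, rfl⟩, w, a, b, h⟩
    obtain ⟨g₀, hg₀⟩ := LinearPMap.mem_domain_iff.1 hf₀
    obtain ⟨w₀, h₀⟩ := (mem_graph_Lmin hm0 hm1).1 hg₀
    have h2 := h₀.add (h₁.smul c)
    have hg : g = g₀ + c • g₁ :=
      (Lmax m).mem_graph_snd_inj ((mem_graph_Lmax hm0 hm1).2 ⟨_, _, _, h⟩)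
        ((mem_graph_Lmax hm0 hm1).2 ⟨_, _, _, h2⟩) rfl
    subst hg
    exact ⟨_, _, _, h2, by simp⟩
  · rintro ⟨w, a, b, h, ha⟩
    have h2 := h.sub (h₁.smul b)
    rw [← ha] at h2
    simp only [mul_zero, mul_one, sub_self] at h2
    refine ⟨⟨_, LinearPMap.mem_domain_of_mem_graph ((mem_graph_Lmin hm0 hm1).2 ⟨_, h2⟩), b, ?_⟩,
      w, a, b, h⟩
    abel

theorem Hop_neg_eq {m : ℝ} (hm0 : 0 < m) (hm1 : m < 1) {ξ : ℝ → ℂ} (hξ : IsCutoff ξ) :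
    Hop ξ (-m) = Htheta m 0 := by
  have hn : -(-m) < 1 := by linarith
  obtain ⟨g₁, w₁, h₁⟩ := exists_bData_cutoff_neg hm0 hm1 hξ hn
  refine LinearPMap.eq_of_eq_graph ?_
  ext ⟨f, g⟩
  rw [mem_graph_Htheta hm0 hm1, Hop, mem_graph_domRestrict, mem_homDomain_iff hξ hn,
    Lmax_neg, Lmin_neg, mem_graph_Lmax hm0 hm1]
  simp only [Real.cos_zero, Real.sin_zero, Complex.ofReal_zero, Complex.ofReal_one,
    zero_mul, one_mul]
  constructor
  · rintro ⟨⟨f₀, hf₀, c, rfl⟩, w, a, b, h⟩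
    obtain ⟨g₀, hg₀⟩ := LinearPMap.mem_domain_iff.1 hf₀
    obtain ⟨w₀, h₀⟩ := (mem_graph_Lmin hm0 hm1).1 hg₀
    have h2 := h₀.add (h₁.smul c)
    have hg : g = g₀ + c • g₁ :=
      (Lmax m).mem_graph_snd_inj ((mem_graph_Lmax hm0 hm1).2 ⟨_, _, _, h⟩)
        ((mem_graph_Lmax hm0 hm1).2 ⟨_, _, _, h2⟩) rfl
    subst hg
    exact ⟨_, _, _, h2, by simp⟩
  · rintro ⟨w, a, b, h, hb⟩
    have h2 := h.sub (h₁.smul a)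
    rw [hb] at h2
    simp only [mul_zero, mul_one, sub_self] at h2
    refine ⟨⟨_, LinearPMap.mem_domain_of_mem_graph ((mem_graph_Lmin hm0 hm1).2 ⟨_, h2⟩), a, ?_⟩,
      w, a, b, h⟩
    abel

/-! ### Self-adjointness and positivity -/

section Extensions

variable {m : ℝ}

theorem BData.re_inner {f g w : L2} {a b : ℂ} (h : BData m f g w a b) :
    (⟪f, g⟫_ℂ).re = ‖w‖ ^ 2 + 2 * m * (conj a * b).re := by
  rw [h.inner_eq h, Complex.add_re, inner_self_eq_norm_sq_to_K]
  congr 1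
  · change ((‖w‖ : ℂ) ^ 2).re = ‖w‖ ^ 2
    rw [← Complex.ofReal_pow, Complex.ofReal_re]
  · rw [show (2 : ℂ) * m = ((2 * m : ℝ) : ℂ) by push_cast; rfl, Complex.re_ofReal_mul]

theorem Lmin_le_Htheta (hm0 : 0 < m) (hm1 : m < 1) (θ : ℝ) : Lmin m ≤ Htheta m θ := by
  refine LinearPMap.le_of_le_graph ?_
  rintro ⟨f, g⟩ h
  obtain ⟨w, hw⟩ := (mem_graph_Lmin hm0 hm1).1 h
  exact (mem_graph_Htheta hm0 hm1).2 ⟨_, _, _, hw, by simp⟩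

/-- The boundary condition says that `(a, b)` is a multiple of `(cos θ, sin θ)`. -/
theorem exists_eq_mul_of_cos_mul_eq {θ : ℝ} {a b : ℂ} (h : Real.cos θ * b = Real.sin θ * a) :
    ∃ t : ℂ, a = t * Real.cos θ ∧ b = t * Real.sin θ := by
  have h1 : (Real.cos θ : ℂ) ^ 2 + (Real.sin θ : ℂ) ^ 2 = 1 := by
    exact_mod_cast Real.cos_sq_add_sin_sq θ
  refine ⟨Real.cos θ * a + Real.sin θ * b, ?_, ?_⟩
  · linear_combination (-a) * h1 - Real.sin θ * h
  · linear_combination (-b) * h1 + Real.cos θ * h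

theorem isSelfAdjoint_Htheta (hm0 : 0 < m) (hm1 : m < 1) (θ : ℝ) :
    IsSelfAdjoint (Htheta m θ) := by
  have hm : (m : ℂ) ≠ 0 := Complex.ofReal_ne_zero.2 hm0.ne'
  refine isSelfAdjoint_of_graph ((dense_Lmin hm0 hm1).mono (Lmin_le_Htheta hm0 hm1 θ).1) ?_
  ext ⟨f, g⟩
  constructor
  · intro h
    rw [Submodule.mem_adjoint_iff] at h
    have hmax : (f, g) ∈ maxGraph m := by
      rw [← adjoint_graph_Lmin hm0 hm1, Submodule.mem_adjoint_iff]
      exact fun a b hab => h a b (LinearPMap.le_graph_of_le (Lmin_le_Htheta hm0 hm1 θ) hab)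
    obtain ⟨w, a, b, hw⟩ := exists_bData hm0 hm1 hmax
    obtain ⟨f₁, g₁, w₁, h₁⟩ := exists_bData_one_zero hm0 hm1
    obtain ⟨f₂, g₂, w₂, h₂⟩ := exists_bData_zero_one hm0 hm1
    have h₀ := (h₁.smul (Real.cos θ)).add (h₂.smul (Real.sin θ))
    have e := h _ _ ((mem_graph_Htheta hm0 hm1).2 ⟨_, _, _, h₀, by ring⟩)
    rw [h₀.inner_comm hw] at e
    simp only [mul_zero, mul_one, add_zero, zero_add, Complex.conj_ofReal] at e
    have e2 := (mul_eq_zero.1 e).resolve_left (mul_ne_zero two_ne_zero hm)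
    exact (mem_graph_Htheta hm0 hm1).2 ⟨w, a, b, hw, (sub_eq_zero.1 e2).symm⟩
  · intro h
    obtain ⟨w, a, b, hw, hab⟩ := (mem_graph_Htheta hm0 hm1).1 h
    obtain ⟨t, rfl, rfl⟩ := exists_eq_mul_of_cos_mul_eq hab
    rw [Submodule.mem_adjoint_iff]
    intro f' g' h'
    obtain ⟨w', a', b', hw', hab'⟩ := (mem_graph_Htheta hm0 hm1).1 h'
    obtain ⟨t', rfl, rfl⟩ := exists_eq_mul_of_cos_mul_eq hab'
    rw [hw'.inner_comm hw]
    simp only [map_mul, Complex.conj_ofReal]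
    ring

theorem re_inner_Htheta_nonneg (hm0 : 0 < m) (hm1 : m < 1) {θ : ℝ} (h0 : 0 ≤ θ)
    (h1 : θ ≤ Real.pi / 2) {f g : L2} (h : (f, g) ∈ (Htheta m θ).graph) :
    ∃ w a b, BData m f g w a b ∧ Real.cos θ * b = Real.sin θ * a ∧ 0 ≤ (conj a * b).re := by
  obtain ⟨w, a, b, hw, hab⟩ := (mem_graph_Htheta hm0 hm1).1 h
  refine ⟨w, a, b, hw, hab, ?_⟩
  obtain ⟨t, rfl, rfl⟩ := exists_eq_mul_of_cos_mul_eq hab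
  have hc : 0 ≤ Real.cos θ := Real.cos_nonneg_of_mem_Icc ⟨by linarith [Real.pi_pos], h1⟩
  have hs : 0 ≤ Real.sin θ := Real.sin_nonneg_of_nonneg_of_le_pi h0 (by linarith [Real.pi_pos])
  have e : conj (t * Real.cos θ) * (t * Real.sin θ) =
      ((Complex.normSq t * (Real.cos θ * Real.sin θ) : ℝ) : ℂ) := by
    rw [map_mul, Complex.conj_ofReal, Complex.ofReal_mul, Complex.normSq_eq_conj_mul_self,
      Complex.ofReal_mul]
    ring
  rw [e, Complex.ofReal_re]
  exact mul_nonneg (Complex.normSq_nonneg t) (mul_nonneg hc hs)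

theorem isPositiveSelfAdjointExtension_Htheta (hm0 : 0 < m) (hm1 : m < 1) {θ : ℝ} (h0 : 0 ≤ θ)
    (h1 : θ ≤ Real.pi / 2) : IsPositiveSelfAdjointExtension (Lmin m) (Htheta m θ) := by
  refine ⟨⟨Lmin_le_Htheta hm0 hm1 θ, isSelfAdjoint_Htheta hm0 hm1 θ⟩, fun x => ?_⟩
  obtain ⟨w, a, b, hw, -, hab⟩ := re_inner_Htheta_nonneg hm0 hm1 h0 h1 (LinearPMap.mem_graph _ x)
  rw [hw.re_inner]
  positivity

theorem isPositiveHermitian_Lmin (hm0 : 0 < m) (hm1 : m < 1) : IsPositiveHermitian (Lmin m) := by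
  refine ⟨⟨dense_Lmin hm0 hm1, fun x y => ?_⟩, fun x => ?_⟩
  · obtain ⟨w, hw⟩ := (mem_graph_Lmin hm0 hm1).1 ((Lmin m).mem_graph x)
    obtain ⟨v, hv⟩ := (mem_graph_Lmin hm0 hm1).1 ((Lmin m).mem_graph y)
    have := hw.inner_comm hv
    simp only [mul_zero, sub_zero] at this
    exact sub_eq_zero.1 this
  · obtain ⟨w, hw⟩ := (mem_graph_Lmin hm0 hm1).1 ((Lmin m).mem_graph x)
    rw [hw.re_inner, mul_zero, Complex.zero_re, mul_zero, add_zero]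
    positivity

/-! ### Eigenfunctions of the maximal operator -/

/-- Outside of `[0, ∞[`, every complex number is at a positive distance from the numerical range of
a positive symmetric operator. -/
theorem exists_norm_le {E : Type*} [NormedAddCommGroup E] [InnerProductSpace ℂ E] {z : ℂ}
    (hz : z.im ≠ 0 ∨ z.re < 0) : ∃ c > 0, ∀ f g : E, (⟪f, g⟫_ℂ).im = 0 → 0 ≤ (⟪f, g⟫_ℂ).re →
      c * ‖f‖ ≤ ‖g - z • f‖ := by
  have key : ∀ c : ℝ, ∀ f k : E, c * ‖f‖ ^ 2 ≤ ‖⟪f, k⟫_ℂ‖ → c * ‖f‖ ≤ ‖k‖ := by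
    intro c f k h
    rcases (norm_nonneg f).eq_or_lt with hf | hf
    · rw [← hf, mul_zero]
      exact norm_nonneg k
    · have h2 := h.trans (norm_inner_le_norm f k)
      refine le_of_mul_le_mul_right ?_ hf
      nlinarith
  have hi : ∀ f g : E, ⟪f, g - z • f⟫_ℂ = ⟪f, g⟫_ℂ - z * ((‖f‖ ^ 2 : ℝ) : ℂ) := by
    intro f g
    rw [inner_sub_right, inner_smul_right, inner_self_eq_norm_sq_to_K]
    push_cast
    rfl
  rcases hz with hz | hz
  · refine ⟨|z.im|, abs_pos.2 hz, fun f g him _ => key _ _ _ ?_⟩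
    refine le_trans (le_of_eq ?_) (Complex.abs_im_le_norm _)
    rw [hi, Complex.sub_im, him, zero_sub, Complex.im_mul_ofReal, abs_neg, abs_mul,
      abs_of_nonneg (sq_nonneg ‖f‖)]
  · refine ⟨-z.re, by linarith, fun f g _ hre => key _ _ _ ?_⟩
    refine le_trans ?_ (Complex.re_le_norm _)
    rw [hi, Complex.sub_re, Complex.re_mul_ofReal]
    linarith

/-- For `z` outside of `[0, ∞[` the kernel of `Lmax - z` is spanned by one function whose boundary
value `a` equals `1`. Indeed `a` is injective on the kernel, because `z` is not an eigenvalue of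
the positive self-adjoint operator `H_m^{π/2}` given by `a = 0`, and it does not vanish because
`H_m^{π/2} - z` is onto. -/
theorem exists_eigenfunction (hm0 : 0 < m) (hm1 : m < 1) {z : ℂ} (hz : z.im ≠ 0 ∨ z.re < 0) :
    ∃ f w b, BData m f (z • f) w 1 b ∧
      ∀ h w' a' b', BData m h (z • h) w' a' b' → h = a' • f := by
  have hsa := isSelfAdjoint_Htheta hm0 hm1 (Real.pi / 2)
  have hpos := isPositiveSelfAdjointExtension_Htheta hm0 hm1 (θ := Real.pi / 2)
    (by positivity) le_rfl
  have hgr : ∀ {f g w : L2} {b : ℂ}, BData m f g w 0 b → (f, g) ∈ (Htheta m (Real.pi / 2)).graph :=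
    fun h => (mem_graph_Htheta hm0 hm1).2 ⟨_, _, _, h, by simp⟩
  have him : ∀ f g, (f, g) ∈ (Htheta m (Real.pi / 2)).graph → (⟪f, g⟫_ℂ).im = 0 := by
    intro f g h
    have h1 := inner_symm_of_isSelfAdjoint hsa h h
    rw [← inner_conj_symm] at h1
    exact Complex.conj_eq_iff_im.1 h1
  have hre : ∀ f g, (f, g) ∈ (Htheta m (Real.pi / 2)).graph → 0 ≤ (⟪f, g⟫_ℂ).re := by
    intro f g h
    have h1 := hpos.2 ⟨f, LinearPMap.mem_domain_of_mem_graph h⟩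
    rwa [apply_eq_of_mem_graph h] at h1
  have hker : ∀ z : ℂ, (z.im ≠ 0 ∨ z.re < 0) →
      ∀ f, (f, z • f) ∈ (Htheta m (Real.pi / 2)).graph → f = 0 := by
    intro z hz f h
    obtain ⟨c, hc, hb⟩ := exists_norm_le (E := L2) hz
    have := hb _ _ (him _ _ h) (hre _ _ h)
    rw [sub_self, norm_zero] at this
    exact norm_le_zero_iff.1 (by nlinarith [norm_nonneg f])
  obtain ⟨c, hc, hb⟩ := exists_norm_le (E := L2) hz
  obtain ⟨f₁, g₁, w₁, h₁⟩ := exists_bData_one_zero hm0 hm1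
  obtain ⟨f₂, hf₂⟩ := exists_graph_eq hsa z hc (fun f g h => hb f g (him f g h) (hre f g h))
    (hker (conj z) (by simpa using hz)) (g₁ - z • f₁)
  obtain ⟨w₂, a₂, b₂, h₂, ha₂⟩ := (mem_graph_Htheta hm0 hm1).1 hf₂
  simp only [Real.cos_pi_div_two, Real.sin_pi_div_two, Complex.ofReal_zero, Complex.ofReal_one,
    zero_mul, one_mul] at ha₂
  subst ha₂
  have h₃ := h₁.sub h₂
  rw [show g₁ - (g₁ - z • f₁ + z • f₂) = z • (f₁ - f₂) by rw [smul_sub]; abel, sub_zero] at h₃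
  refine ⟨f₁ - f₂, _, _, h₃, fun h w' a' b' h' => ?_⟩
  have h₄ := h'.sub (h₃.smul a')
  rw [mul_one, sub_self, smul_comm a' z, ← smul_sub] at h₄
  exact sub_eq_zero.1 (hker z hz _ (hgr h₄))

theorem BData.ne_zero {z : ℂ} (hm0 : 0 < m) {f w : L2} {b : ℂ} (h : BData m f (z • f) w 1 b) :
    f ≠ 0 := by
  rintro rfl
  rw [smul_zero] at h
  exact one_ne_zero (h.eq_zero hm0).2.1

theorem rank_eigenspace_Lmax (hm0 : 0 < m) (hm1 : m < 1) {z : ℂ} (hz : z.im ≠ 0 ∨ z.re < 0) :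
    Module.rank ℂ (eigenspace (Lmax m) z) = 1 := by
  obtain ⟨f, w, b, h, huniq⟩ := exists_eigenfunction hm0 hm1 hz
  refine (rank_submodule_eq_one_iff _).2 ⟨f, mem_eigenspace_iff.2
    ((mem_graph_Lmax hm0 hm1).2 ⟨_, _, _, h⟩), h.ne_zero hm0, fun x hx => ?_⟩
  obtain ⟨w', a', b', h'⟩ := (mem_graph_Lmax hm0 hm1).1 (mem_eigenspace_iff.1 hx)
  rw [huniq _ _ _ _ h']
  exact Submodule.smul_mem _ _ (Submodule.mem_span_singleton_self f)

theorem hasDeficiencyIndices_Lmin (hm0 : 0 < m) (hm1 : m < 1) :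
    HasDeficiencyIndices (Lmin m) 1 1 := by
  rw [HasDeficiencyIndices, adjoint_Lmin hm0 hm1]
  simp only [Nat.cast_one]
  exact ⟨rank_eigenspace_Lmax hm0 hm1 (Or.inl (by simp)),
    rank_eigenspace_Lmax hm0 hm1 (Or.inl (by simp))⟩

/-- The boundary values of the eigenfunctions for negative eigenvalues: for the eigenvalue `-1` the
ratio `b / a` is negative by Green's identity, and dilations give the other eigenvalues. -/
theorem exists_neg_eigenfunction (hm0 : 0 < m) (hm1 : m < 1) :
    ∃ β : ℝ, 0 < β ∧ ∀ k : ℝ, 0 < k → ∃ f w,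
      BData m f (((-k ^ 2 : ℝ) : ℂ) • f) w 1 ((-β * k ^ (2 * m) : ℝ) : ℂ) := by
  obtain ⟨f, w, b, h, -⟩ := exists_eigenfunction hm0 hm1 (z := -1) (Or.inr (by simp))
  have hf : 0 < ‖f‖ := norm_pos_iff.2 (h.ne_zero hm0)
  have hm : (m : ℂ) ≠ 0 := Complex.ofReal_ne_zero.2 hm0.ne'
  have hb : b = ((-((‖f‖ ^ 2 + ‖w‖ ^ 2) / (2 * m)) : ℝ) : ℂ) := by
    have e := h.inner_eq h
    rw [inner_smul_right, inner_self_eq_norm_sq_to_K, inner_self_eq_norm_sq_to_K, map_one,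
      one_mul] at e
    have e' : (-1 : ℂ) * (‖f‖ : ℂ) ^ 2 = (‖w‖ : ℂ) ^ 2 + 2 * m * b := e
    push_cast
    field_simp
    linear_combination -e'
  refine ⟨(‖f‖ ^ 2 + ‖w‖ ^ 2) / (2 * m), by positivity, fun k hk => ?_⟩
  have hp := pw_ne_zero m hk
  have h2 := (h.dil hk).smul (pw m k)⁻¹
  refine ⟨(pw m k)⁻¹ • dil hk f, (pw m k)⁻¹ • (k : ℂ) • dil hk w, ?_⟩
  convert h2 using 1
  · rw [dil_smul, smul_smul, smul_smul, smul_smul]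
    congr 1
    push_cast
    ring
  · field_simp
  · rw [hb, Complex.ofReal_mul, ← pw_neg_div hk]
    field_simp

theorem exists_neg_eigenvalue (hm0 : 0 < m) (hm1 : m < 1) {θ : ℝ} (h0 : Real.pi / 2 < θ)
    (h1 : θ < Real.pi) : ∃ μ : ℝ, μ < 0 ∧
      Module.rank ℂ (eigenspace (Htheta m θ) (μ : ℂ)) = 1 ∧
      ∀ μ' : ℝ, μ' < 0 → eigenspace (Htheta m θ) (μ' : ℂ) ≠ ⊥ → μ' = μ := by
  obtain ⟨β, hβ, H⟩ := exists_neg_eigenfunction hm0 hm1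
  have hc : Real.cos θ < 0 := Real.cos_neg_of_pi_div_two_lt_of_lt h0 (by linarith)
  have hs : 0 < Real.sin θ := Real.sin_pos_of_pos_of_lt_pi (by linarith [Real.pi_pos]) h1
  have hm2 : 2 * m ≠ 0 := by positivity
  -- `f_k` satisfies the boundary condition exactly when `k ^ (2 * m) = r`.
  set r : ℝ := Real.sin θ / (-Real.cos θ * β)
  have hcβ : 0 < -Real.cos θ * β := mul_pos (by linarith) hβ
  have hr : 0 < r := div_pos hs hcβ
  set k : ℝ := r ^ (1 / (2 * m))
  have hk : 0 < k := Real.rpow_pos_of_pos hr _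
  have hkr : k ^ (2 * m) = r := by
    rw [← Real.rpow_mul hr.le, one_div_mul_cancel hm2, Real.rpow_one]
  have hre : ∀ {μ : ℝ}, μ < 0 → ((μ : ℂ).im ≠ 0 ∨ (μ : ℂ).re < 0) := fun h =>
    Or.inr (by simpa using h)
  have hμ : -k ^ 2 < 0 := by
    have := pow_pos hk 2
    linarith
  refine ⟨-k ^ 2, hμ, ?_, fun μ' hμ' hne => ?_⟩
  · obtain ⟨f, w, hf⟩ := H k hk
    obtain ⟨f', w', b', h', huniq⟩ := exists_eigenfunction hm0 hm1 (hre hμ)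
    refine (rank_submodule_eq_one_iff _).2 ⟨f, mem_eigenspace_iff.2
      ((mem_graph_Htheta hm0 hm1).2 ⟨_, _, _, hf, ?_⟩), hf.ne_zero hm0, fun x hx => ?_⟩
    · rw [hkr, mul_one, ← Complex.ofReal_mul]
      congr 1
      have : r * (-Real.cos θ * β) = Real.sin θ := div_mul_cancel₀ _ hcβ.ne'
      linarith
    · obtain ⟨v, a, b, hv, -⟩ := (mem_graph_Htheta hm0 hm1).1 (mem_eigenspace_iff.1 hx)
      have e : f = f' := by rw [huniq _ _ _ _ hf, one_smul]
      rw [huniq _ _ _ _ hv, e]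
      exact Submodule.smul_mem _ _ (Submodule.mem_span_singleton_self f')
  · obtain ⟨x, hx, hx0⟩ := Submodule.exists_mem_ne_zero_of_ne_bot hne
    obtain ⟨v, a, b, hv, hab⟩ := (mem_graph_Htheta hm0 hm1).1 (mem_eigenspace_iff.1 hx)
    have hk' : 0 < Real.sqrt (-μ') := Real.sqrt_pos.2 (by linarith)
    have hk2 : -Real.sqrt (-μ') ^ 2 = μ' := by
      rw [Real.sq_sqrt (by linarith), neg_neg]
    obtain ⟨f, w, hf⟩ := H _ hk'
    rw [hk2] at hf
    obtain ⟨f', w', b', h', huniq⟩ := exists_eigenfunction hm0 hm1 (hre hμ')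
    have e : f = f' := by rw [huniq _ _ _ _ hf, one_smul]
    have hxa : x = a • f := by rw [huniq _ _ _ _ hv, e]
    have ha : a ≠ 0 := by
      rintro rfl
      exact hx0 (by rw [hxa, zero_smul])
    have h2 := hf.smul a
    rw [smul_comm, ← hxa] at h2
    have hb := (hv.unique hm0 h2).2.2
    rw [hb, mul_left_comm, mul_comm (Real.sin θ : ℂ) a] at hab
    have h3 := mul_left_cancel₀ ha hab
    rw [← Complex.ofReal_mul] at h3
    have h4 : Real.cos θ * (-β * Real.sqrt (-μ') ^ (2 * m)) = Real.sin θ :=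
      Complex.ofReal_injective h3
    have h5 : Real.sqrt (-μ') ^ (2 * m) = k ^ (2 * m) := by
      rw [hkr, eq_div_iff hcβ.ne']
      linarith
    rw [← hk2, (Real.rpow_left_inj hk'.le hk.le hm2).1 h5]

/-! ### The Friedrichs and Krein extensions -/

theorem norm_smul_dil_sq {l : ℝ} (hl : 0 < l) (c : ℂ) (f : L2) :
    ‖c • dil hl f‖ ^ 2 = ‖c‖ ^ 2 * l⁻¹ * ‖f‖ ^ 2 := by
  rw [norm_smul, mul_pow, norm_dil_sq]
  ring

/-- Concentrating a function near the origin by dilations makes `f` and `A f` small while its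
boundary values stay equal to `(0, 1)`. -/
theorem exists_bData_zero_one_small (hm0 : 0 < m) (hm1 : m < 1) {ε : ℝ} (hε : 0 < ε) :
    ∃ f g w, BData m f g w 0 1 ∧ ‖f‖ < ε ∧ ‖w‖ < ε := by
  obtain ⟨f, g, w, h⟩ := exists_bData_zero_one hm0 hm1
  have t1 : Tendsto (fun l : ℝ => l ^ (-(2 + 2 * m)) * ‖f‖ ^ 2) atTop (𝓝 0) := by
    simpa using (tendsto_rpow_neg_atTop (y := 2 + 2 * m) (by linarith)).mul_const (‖f‖ ^ 2)
  have t2 : Tendsto (fun l : ℝ => l ^ (-(2 * m)) * ‖w‖ ^ 2) atTop (𝓝 0) := by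
    simpa using (tendsto_rpow_neg_atTop (y := 2 * m) (by linarith)).mul_const (‖w‖ ^ 2)
  have hε2 : 0 < ε ^ 2 := by positivity
  obtain ⟨l, hl1, hl2, hl⟩ := ((t1.eventually_lt_const hε2).and
    ((t2.eventually_lt_const hε2).and (eventually_gt_atTop 0))).exists
  have hp := pw_ne_zero (-m) hl
  have h2 := (h.dil hl).smul (pw (-m) l)⁻¹
  rw [mul_zero, mul_zero, mul_one, inv_mul_cancel₀ hp] at h2
  refine ⟨_, _, _, h2, lt_of_pow_lt_pow_left₀ 2 hε.le (lt_of_eq_of_lt ?_ hl1),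
    lt_of_pow_lt_pow_left₀ 2 hε.le (lt_of_eq_of_lt ?_ hl2)⟩
  · rw [norm_smul_dil_sq, norm_inv, inv_pow, norm_pw_sq hl, ← Real.rpow_neg hl.le,
      ← Real.rpow_neg_one l, ← Real.rpow_add hl]
    congr 2
    ring
  · rw [smul_smul, norm_smul_dil_sq, norm_mul, mul_pow, norm_inv, inv_pow, norm_pw_sq hl,
      ← Real.rpow_neg hl.le, Complex.norm_real, Real.norm_of_nonneg hl.le, ← Real.rpow_neg_one l,
      ← Real.rpow_natCast l 2, ← Real.rpow_add hl, ← Real.rpow_add hl]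
    congr 2
    push_cast
    ring

/-- Spreading a function by dilations makes `A f` small while its boundary values stay equal to
`(1, 0)`. -/
theorem exists_bData_one_zero_small (hm0 : 0 < m) (hm1 : m < 1) {ε : ℝ} (hε : 0 < ε) :
    ∃ f g w, BData m f g w 1 0 ∧ ‖w‖ < ε := by
  obtain ⟨f, g, w, h⟩ := exists_bData_one_zero hm0 hm1
  have t2 : Tendsto (fun l : ℝ => l ^ (2 * m) * ‖w‖ ^ 2) (𝓝[>] 0) (𝓝 0) := by
    have := ((Real.continuousAt_rpow_const 0 (2 * m) (Or.inr (by positivity))).tendsto).mul_const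
      (‖w‖ ^ 2)
    rw [Real.zero_rpow (by positivity), zero_mul] at this
    exact this.mono_left nhdsWithin_le_nhds
  have hε2 : 0 < ε ^ 2 := by positivity
  obtain ⟨l, hl2, hl⟩ := ((t2.eventually_lt_const hε2).and self_mem_nhdsWithin).exists
  have hl : 0 < l := hl
  have hp := pw_ne_zero m hl
  have h2 := (h.dil hl).smul (pw m l)⁻¹
  rw [mul_zero, mul_zero, mul_one, inv_mul_cancel₀ hp] at h2
  refine ⟨_, _, _, h2, lt_of_pow_lt_pow_left₀ 2 hε.le (lt_of_eq_of_lt ?_ hl2)⟩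
  rw [smul_smul, norm_smul_dil_sq, norm_mul, mul_pow, norm_inv, inv_pow, norm_pw_sq hl,
    ← Real.rpow_neg hl.le, Complex.norm_real, Real.norm_of_nonneg hl.le, ← Real.rpow_neg_one l,
    ← Real.rpow_natCast l 2, ← Real.rpow_add hl, ← Real.rpow_add hl]
  congr 2
  push_cast
  ring

theorem mem_maxGraph_of_extension (hm0 : 0 < m) (hm1 : m < 1) {H : L2 →ₗ.[ℂ] L2}
    (hH : IsSelfAdjointExtension (Lmin m) H) {f g : L2} (h : (f, g) ∈ H.graph) :
    (f, g) ∈ maxGraph m := by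
  rw [← adjoint_graph_of_isSelfAdjoint hH.2, Submodule.mem_adjoint_iff] at h
  rw [← adjoint_graph_Lmin hm0 hm1, Submodule.mem_adjoint_iff]
  exact fun a b hab => h a b (LinearPMap.le_graph_of_le hH.1 hab)

/-- On the domain of a positive self-adjoint extension `Re (ā b) ≥ 0`: modulo the minimal domain,
every element may be replaced by one with the same boundary values and with `A f` arbitrarily
small, whose energy is then arbitrarily close to `2 m Re (ā b)`. -/
theorem re_conj_mul_nonneg (hm0 : 0 < m) (hm1 : m < 1) {H : L2 →ₗ.[ℂ] L2}
    (hH : IsPositiveSelfAdjointExtension (Lmin m) H) {f g w : L2} {a b : ℂ}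
    (h : BData m f g w a b) (hfg : (f, g) ∈ H.graph) : 0 ≤ (conj a * b).re := by
  have key : ∀ ε : ℝ, 0 < ε → 0 ≤ ((‖a‖ + ‖b‖) * ε) ^ 2 + 2 * m * (conj a * b).re := by
    intro ε hε
    obtain ⟨f₁, g₁, w₁, h₁, hw₁⟩ := exists_bData_one_zero_small hm0 hm1 hε
    obtain ⟨f₂, g₂, w₂, h₂, -, hw₂⟩ := exists_bData_zero_one_small hm0 hm1 hε
    have h₃ := (h₁.smul a).add (h₂.smul b)
    simp only [mul_one, mul_zero, add_zero, zero_add] at h₃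
    have h₄ := h₃.sub h
    rw [sub_self, sub_self] at h₄
    have h₅ := LinearPMap.le_graph_of_le hH.1.1 ((mem_graph_Lmin hm0 hm1).2 ⟨_, h₄⟩)
    have h₆ := H.graph.add_mem h₅ hfg
    rw [Prod.mk_add_mk, sub_add_cancel, sub_add_cancel] at h₆
    have h₇ := hH.2 ⟨_, LinearPMap.mem_domain_of_mem_graph h₆⟩
    rw [apply_eq_of_mem_graph h₆, h₃.re_inner] at h₇
    refine h₇.trans (add_le_add (pow_le_pow_left₀ (norm_nonneg _) ?_ 2) le_rfl)
    calc ‖a • w₁ + b • w₂‖ ≤ ‖a‖ * ‖w₁‖ + ‖b‖ * ‖w₂‖ := by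
          rw [← norm_smul, ← norm_smul]
          exact norm_add_le _ _
      _ ≤ ‖a‖ * ε + ‖b‖ * ε := by gcongr
      _ = (‖a‖ + ‖b‖) * ε := by ring
  have hlim : Tendsto (fun ε : ℝ => ((‖a‖ + ‖b‖) * ε) ^ 2 + 2 * m * (conj a * b).re) (𝓝[>] 0)
      (𝓝 (((‖a‖ + ‖b‖) * 0) ^ 2 + 2 * m * (conj a * b).re)) :=
    (Continuous.tendsto (by fun_prop) 0).mono_left nhdsWithin_le_nhds
  have h0 := ge_of_tendsto hlim (by filter_upwards [self_mem_nhdsWithin] with ε hε using key ε hε)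
  rw [mul_zero, zero_pow two_ne_zero, zero_add] at h0
  exact nonneg_of_mul_nonneg_right h0 (by positivity)

/-- Comparison of forms: the energy of an element of `B` is `‖A f‖² + 2 m Re (ā b)`. Subtracting
a concentrated function with boundary values `(0, b)` leads into the domain of `A` at a
negligible cost in `f` and `A f`, and removes the nonnegative boundary term. -/
theorem formLE_of_bData (hm0 : 0 < m) (hm1 : m < 1) {A B : L2 →ₗ.[ℂ] L2}
    (hB : ∀ f g, (f, g) ∈ B.graph → ∃ w a b, BData m f g w a b ∧ 0 ≤ (conj a * b).re ∧
      ∀ f' g' w', BData m f' g' w' a 0 → (f', g') ∈ A.graph) : FormLE A B := by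
  rintro x r ⟨u, hux, huq, hur⟩
  choose w a b hw hab hA using fun n => hB _ _ (B.mem_graph (u n))
  have hsmall : ∀ n : ℕ, ∃ f g κ, BData m f g κ 0 1 ∧ ‖b n • f‖ ≤ 1 / ((n : ℝ) + 1) ∧
      ‖b n • κ‖ ≤ 1 / ((n : ℝ) + 1) := by
    intro n
    have hn : (0 : ℝ) < (n : ℝ) + 1 := by positivity
    have hb : 0 < ‖b n‖ + 1 := by positivity
    obtain ⟨f, g, κ, h, h1, h2⟩ := exists_bData_zero_one_small hm0 hm1
      (ε := 1 / ((n : ℝ) + 1) / (‖b n‖ + 1)) (by positivity)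
    have hle : ∀ v : L2, ‖v‖ < 1 / ((n : ℝ) + 1) / (‖b n‖ + 1) → ‖b n • v‖ ≤ 1 / ((n : ℝ) + 1) := by
      intro v hv
      rw [lt_div_iff₀ hb] at hv
      rw [norm_smul]
      nlinarith [norm_nonneg v, norm_nonneg (b n)]
    exact ⟨f, g, κ, h, hle f h1, hle κ h2⟩
  choose η γ κ hη hη1 hκ1 using hsmall
  have hv : ∀ n, BData m ((u n : L2) - b n • η n) (B (u n) - b n • γ n) (w n - b n • κ n)
      (a n) 0 := by
    intro n
    simpa using (hw n).sub ((hη n).smul (b n))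
  have hvA := fun n => hA n _ _ _ (hv n)
  have he : Tendsto (fun n : ℕ => 1 / ((n : ℝ) + 1)) atTop (𝓝 0) :=
    tendsto_one_div_add_atTop_nhds_zero_nat
  set y : ℕ → L2 := fun n => w n - b n • κ n with hy
  have hwy : ∀ n, ‖w n - y n‖ ≤ 1 / ((n : ℝ) + 1) := fun n => by
    rw [hy]
    simpa using hκ1 n
  have hwq : ∀ n k, ‖w n - w k‖ ^ 2 ≤
      (⟪((u n - u k : B.domain) : L2), B (u n - u k)⟫_ℂ).re := by
    intro n k
    obtain ⟨w', a', b', h', hab', -⟩ := hB _ _ (B.mem_graph (u n - u k))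
    have h2 := (hw n).sub (hw k)
    rw [← B.map_sub] at h2
    rw [(h'.unique hm0 h2).1.symm, h'.re_inner]
    have : 0 ≤ 2 * m * (conj a' * b').re := by positivity
    linarith
  have hyq : ∀ n k, ‖y n - y k‖ ≤ 1 / ((n : ℝ) + 1) +
      √(⟪((u n - u k : B.domain) : L2), B (u n - u k)⟫_ℂ).re + 1 / ((k : ℝ) + 1) := by
    intro n k
    have h1 : y n - y k = -(w n - y n) + (w n - w k) + (w k - y k) := by abel
    rw [h1]
    refine (norm_add_le _ _).trans (add_le_add ((norm_add_le _ _).trans (add_le_add ?_ ?_)) (hwy k))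
    · rw [norm_neg]
      exact hwy n
    · exact Real.le_sqrt_of_sq_le (hwq n k)
  have hy0 : Tendsto (fun p : ℕ × ℕ => ‖y p.1 - y p.2‖) atTop (𝓝 0) := by
    rw [← prod_atTop_atTop_eq] at huq ⊢
    have h1 := ((he.comp tendsto_fst).add ((Real.continuous_sqrt.tendsto 0).comp huq)).add
      (he.comp (tendsto_snd (f := (atTop : Filter ℕ)) (g := (atTop : Filter ℕ))))
    rw [Real.sqrt_zero, add_zero, add_zero] at h1
    exact squeeze_zero (fun _ => norm_nonneg _) (fun p => hyq p.1 p.2) h1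
  have hyc : CauchySeq y := by
    rw [cauchySeq_iff_tendsto_dist_atTop_0]
    simpa only [dist_eq_norm] using hy0
  obtain ⟨Y, hY⟩ := cauchySeq_tendsto_of_complete hyc
  have hwY : Tendsto w atTop (𝓝 Y) := by
    have h1 : Tendsto (fun n => w n - y n) atTop (𝓝 0) := squeeze_zero_norm hwy he
    simpa using h1.add hY
  refine ⟨‖Y‖ ^ 2, le_of_tendsto_of_tendsto' (hwY.norm.pow 2) hur fun n => ?_,
    fun n => ⟨_, LinearPMap.mem_domain_of_mem_graph (hvA n)⟩, ?_, ?_, ?_⟩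
  · rw [(hw n).re_inner]
    have : 0 ≤ 2 * m * (conj (a n) * b n).re := mul_nonneg (by positivity) (hab n)
    linarith
  · have h1 : Tendsto (fun n => b n • η n) atTop (𝓝 0) := squeeze_zero_norm hη1 he
    simpa using hux.sub h1
  · have h1 := hy0.pow 2
    rw [zero_pow two_ne_zero] at h1
    refine h1.congr fun p => ?_
    rw [A.map_sub, apply_eq_of_mem_graph (hvA p.1), apply_eq_of_mem_graph (hvA p.2)]
    have h2 := ((hv p.1).sub (hv p.2)).re_inner
    rw [sub_self, mul_zero, Complex.zero_re, mul_zero, add_zero] at h2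
    exact h2.symm
  · refine (hY.norm.pow 2).congr fun n => ?_
    rw [apply_eq_of_mem_graph (hvA n), (hv n).re_inner, mul_zero, Complex.zero_re, mul_zero,
      add_zero]

theorem isFriedrichsExtension_Htheta (hm0 : 0 < m) (hm1 : m < 1) :
    IsFriedrichsExtension (Lmin m) (Htheta m (Real.pi / 2)) := by
  refine ⟨isPositiveSelfAdjointExtension_Htheta hm0 hm1 (by positivity) le_rfl, fun H hH =>
    formLE_of_bData hm0 hm1 fun f g h => ?_⟩
  obtain ⟨w, a, b, hw, ha⟩ := (mem_graph_Htheta hm0 hm1).1 h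
  simp only [Real.cos_pi_div_two, Real.sin_pi_div_two, Complex.ofReal_zero, Complex.ofReal_one,
    zero_mul, one_mul] at ha
  subst ha
  exact ⟨w, 0, b, hw, by simp, fun f' g' w' h' =>
    LinearPMap.le_graph_of_le hH.1.1 ((mem_graph_Lmin hm0 hm1).2 ⟨_, h'⟩)⟩

theorem isKreinExtension_Htheta (hm0 : 0 < m) (hm1 : m < 1) :
    IsKreinExtension (Lmin m) (Htheta m 0) := by
  refine ⟨isPositiveSelfAdjointExtension_Htheta hm0 hm1 le_rfl (by positivity), fun H hH =>
    formLE_of_bData hm0 hm1 fun f g h => ?_⟩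
  obtain ⟨w, a, b, hw⟩ := exists_bData hm0 hm1 (mem_maxGraph_of_extension hm0 hm1 hH.1 h)
  exact ⟨w, a, b, hw, re_conj_mul_nonneg hm0 hm1 hH hw h, fun f' g' w' h' =>
    (mem_graph_Htheta hm0 hm1).2 ⟨_, _, _, h', by simp⟩⟩

end Extensions

end HomSchrodinger

end

theorem mainTheorem6 (m : ℝ) (hm0 : 0 < m) (hm1 : m < 1)
    (ξ : ℝ → ℂ) (hξ : HomSchrodinger.IsCutoff ξ) :
    HomSchrodinger.IsPositiveHermitian (HomSchrodinger.Lmin m) ∧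
    HomSchrodinger.HasDeficiencyIndices (HomSchrodinger.Lmin m) 1 1 ∧
    HomSchrodinger.Hop ξ m = HomSchrodinger.Htheta m (Real.pi / 2) ∧
    HomSchrodinger.Hop ξ (-m) = HomSchrodinger.Htheta m 0 ∧
    HomSchrodinger.IsFriedrichsExtension (HomSchrodinger.Lmin m) (HomSchrodinger.Hop ξ m) ∧
    HomSchrodinger.IsKreinExtension (HomSchrodinger.Lmin m) (HomSchrodinger.Hop ξ (-m)) ∧
    (∀ θ : ℝ, 0 ≤ θ → θ ≤ Real.pi / 2 →
      HomSchrodinger.IsPositiveSelfAdjointExtension (HomSchrodinger.Lmin m)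
        (HomSchrodinger.Htheta m θ)) ∧
    (∀ θ : ℝ, Real.pi / 2 < θ → θ < Real.pi →
      HomSchrodinger.IsSelfAdjointExtension (HomSchrodinger.Lmin m) (HomSchrodinger.Htheta m θ) ∧
      ∃ μ : ℝ, μ < 0 ∧
        Module.rank ℂ (HomSchrodinger.eigenspace (HomSchrodinger.Htheta m θ) (μ : ℂ)) = 1 ∧
        ∀ μ' : ℝ, μ' < 0 →
          HomSchrodinger.eigenspace (HomSchrodinger.Htheta m θ) (μ' : ℂ) ≠ ⊥ → μ' = μ) := by
  have hF := HomSchrodinger.Hop_eq hm0 hm1 hξ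
  have hK := HomSchrodinger.Hop_neg_eq hm0 hm1 hξ
  refine ⟨HomSchrodinger.isPositiveHermitian_Lmin hm0 hm1,
    HomSchrodinger.hasDeficiencyIndices_Lmin hm0 hm1, hF, hK, ?_, ?_,
    fun θ h0 h1 => HomSchrodinger.isPositiveSelfAdjointExtension_Htheta hm0 hm1 h0 h1,
    fun θ h0 h1 => ⟨⟨HomSchrodinger.Lmin_le_Htheta hm0 hm1 θ,
      HomSchrodinger.isSelfAdjoint_Htheta hm0 hm1 θ⟩,
      HomSchrodinger.exists_neg_eigenvalue hm0 hm1 h0 h1⟩⟩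
  · rw [hF]
    exact HomSchrodinger.isFriedrichsExtension_Htheta hm0 hm1
  · rw [hK]
    exact HomSchrodinger.isKreinExtension_Htheta hm0 hm1
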